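/- \textbf{Structural correspondence.} Processes are those of the finite $\pi$-calculus, $P ::= \mathbf 0 \mid \overline b a.P \mid b(x).P \mid P\,|\,P \mid \nu a(P)$, over disjoint infinite sets of names and variables, with channels $b$ and objects $a$ that are names or variables. As usual, all bound names and variables of the initial process are pairwise distinct and distinct from its free ones. \emph{Reversible processes} decorate channels with instantiators ($*$ initially), keep executed prefixes $\alpha[i,K].X$ with a key $i$ and a contextual cause set $K$ (a set of keys and $*$), and decorate restrictions $\nu a_{\Gamma_w}$ with a set of keys $\Gamma$ indexed by $w$, a key or $*$ ($\emptyset_*$ initially; empty iff $\Gamma=\emptyset$ and $w=*$). Their forward transitions $X\to^{\mu} X'$, $\mu=(i,K,j):\pi$, with $\pi$ of the form $\overline b a$, $b(x)$, $\overline b\langle\nu a_{\Gamma_w}\rangle$ or $\tau$, are those of the parametric framework for reversible $\pi$-calculi (rules Out, In, Par, Res, Com, Cause Ref, Open, Close) in which an executed prefix lets through every action of its continuation with a key fresh for the whole process, an empty restriction $\nu a$ does not let out $a$ on the channel $a$ itself, both predicates $\mathrm{Cause}(\Gamma_w,K,K')$ and $\mathrm{Update}(\Gamma_w,K,K')$ mean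 $K'=K\cup\{w\}$, and $\Gamma_w+i$ is $(\Gamma\cup\{i\})_i$ if $w=*$ and $(\Gamma\cup\{i\})_w$ otherwise. Erasing $\varphi$ deletes executed prefixes, decorations, and the restrictions with non-empty memory. \emph{Causal processes} $A ::= P\mid \mathtt K::A\mid A\,|\,A\mid \nu a(A)$ have the Boreale--Sangiorgi causal transitions in late style, $A\to^{K_B}_{\zeta}A'$, where $\zeta$ is $k:\pi$ ($\pi$ an input, a free or a bound output; $k$ a key) or $\tau$. An executed prefix $\alpha.P$ becomes $\{k\}::P$ with cause set $\emptyset$, every enclosing $\mathtt K::$ adds $\mathtt K$ to the cause set, and a synchronisation of two actions with fresh key $k$ and cause sets $K_1,K_2$ replaces $k$ by $K_2$ in the cause sets of the first residual and by $K_1$ in those of the second. For $\zeta=k:\pi$, $K_B$ is the cause set of the action; a silent label shows no causes, and for $\zeta=\tau$, $K_B$ denotes the union of the cause sets of the two synchronising actions. Erasing $\lambda$ deletes all $\mathtt K::$. The function $\gamma$ maps $(i,K,j):\tau$ to $\tau$ and $(i,K,j):\pi$ to $i:\gamma(\pi)$ if $\pi\ne\tau$, where $\gamma$ is the identity on $\overline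 b a$ and $b(x)$, and $\gamma(\overline b\langle\nu a_{\Gamma_w}\rangle)$ is the bound output $\overline b(a)$ if $\Gamma_w$ is empty and the free output $\overline b a$ otherwise. For a transition $X\to^{\mu}X'$ with key $i$, let $G$ be the directed graph whose vertices are the occurrences of executed prefixes of $X'$, named by their keys, with an edge from each prefix to the prefixes in its scope, and edges in both directions between different vertices with the same key. Let $G(i)$ be the subgraph of all paths that end in a vertex with key $i$. $K_F$ is the multiset of the keys other than $i$ of the vertices of $G(i)$, and $\mathtt{Rem}(K_F)$ is the set of those keys of $K_F$ that are still names of vertices after all bidirectional edges of $G(i)$ have been contracted to fresh vertices $\tau_l$. Write $X\to^{\mu}_{K_F}X'$. Let $P$ be an initial $\pi$-calculus process, $n\ge 0$, and let $A_1$ and $X_1$ be $P$, seen as a causal process and as a reversible process. \begin{enumerate} \item If $A_1\to^{K_{B1}}_{\zeta_1}A_2\cdots A_n\to^{K_{Bn}}_{\zeta_n}A_{n+1}$, then there is a trace $X_1\to^{\mu_1}_{K_{F1}}X_2\cdots X_n\to^{\mu_n}_{K_{Fn}}X_{n+1}$ such that $\lambda(A_i)=\varphi(X_i)$ for $1\le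 i\le n+1$, and $\zeta_i=\gamma(\mu_i)$ and $\mathtt{Rem}(K_{Fi})=K_{Bi}$ for $1\le i\le n$. \item Conversely, if $X_1\to^{\mu_1}_{K_{F1}}X_2\cdots X_n\to^{\mu_n}_{K_{Fn}}X_{n+1}$, then there is a trace $A_1\to^{K_{B1}}_{\zeta_1}A_2\cdots A_n\to^{K_{Bn}}_{\zeta_n}A_{n+1}$ such that $\lambda(A_i)=\varphi(X_i)$ for $1\le i\le n+1$, and $\zeta_i=\gamma(\mu_i)$ and $\mathtt{Rem}(K_{Fi})=K_{Bi}$ for $1\le i\le n$. \end{enumerate} -/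

import Mathlib

namespace PiCausal

/-! ## Names, variables, keys -/

abbrev Name := ℕ
abbrev Var := ℕ
abbrev Key := ℕ

/-- Keys extended with the special key `*`, which is `none`. -/
abbrev SKey := Option Key

/-- What may stand in subject or output-object position: a name or a variable. -/
inductive Atom : Type
  | name (a : Name)
  | var (x : Var)

/-- An atom decorated with its instantiator. -/
abbrev DAtom := Atom × SKey

open Classical in
/-- Replaces the variable `x` by `v`. -/
noncomputable def Atom.replace (x : Var) (v c : Atom) : Atom :=
  if c = .var x then v else c

open Classical in
/-- Replaces the variable `x` by `v`, decorated with the instantiator `i`. -/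
noncomputable def replaceD (x : Var) (v : Atom) (i : Key) (c : DAtom) : DAtom :=
  if c.1 = .var x then (v, some i) else c

/-! ## π-calculus processes -/

/-- π-calculus syntax over a type `α` of channels: `Proc Atom` are the π-calculus processes and
`Proc DAtom` are the processes whose channels are decorated with instantiators. -/
inductive Proc (α : Type) : Type
  | nil
  | out (b a : α) (P : Proc α)
  | inp (b : α) (x : Var) (P : Proc α)
  | par (P Q : Proc α)
  | res (a : Name) (P : Proc α)

namespace Proc

def map {α β : Type} (f : α → β) : Proc α → Proc β
  | nil => nil
  | out b a P => out (f b) (f a) (P.map f)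
  | inp b x P => inp (f b) x (P.map f)
  | par P Q => par (P.map f) (Q.map f)
  | res a P => res a (P.map f)

/-- Applies `f` to every channel occurrence outside the scope of the input binders of `x`. -/
def substBy {α : Type} (x : Var) (f : α → α) : Proc α → Proc α
  | nil => nil
  | out b a P => out (f b) (f a) (P.substBy x f)
  | inp b y P => inp (f b) y (if y = x then P else P.substBy x f)
  | par P Q => par (P.substBy x f) (Q.substBy x f)
  | res a P => res a (P.substBy x f)

/-- The substitution `P{v/x}`. It is used only on processes in which no capture can occur. -/
noncomputable def subst (P : Proc Atom) (x : Var) (v : Atom) : Proc Atom :=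
  P.substBy x (Atom.replace x v)

/-- Free names and free variables. -/
def free : Proc Atom → Set Atom
  | nil => ∅
  | out b a P => {b, a} ∪ P.free
  | inp b x P => {b} ∪ (P.free \ {.var x})
  | par P Q => P.free ∪ Q.free
  | res a P => P.free \ {.name a}

/-- The list of all binders of a process. -/
def binders : Proc Atom → List Atom
  | nil => []
  | out _ _ P => P.binders
  | inp _ x P => .var x :: P.binders
  | par P Q => P.binders ++ Q.binders
  | res a P => .name a :: P.binders

/-- The usual convention on bound names and variables: they are pairwise distinct, and distinct
from the free ones. There is no replication, hence binders are never copied and α-conversion is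
never needed in a computation that starts from such a process. -/
def BoundDistinct (P : Proc Atom) : Prop :=
  P.binders.Nodup ∧ ∀ c ∈ P.binders, c ∉ P.free

end Proc

/-! ## The memory of a restriction: indexed sets of keys -/

/-- An indexed set `Γ_w`. -/
structure Mem : Type where
  set : Set Key
  idx : SKey

namespace Mem

/-- `∅_*` -/
def init : Mem := ⟨∅, none⟩

def Empty (δ : Mem) : Prop := δ.set = ∅ ∧ δ.idx = none

/-- `Γ_w + i` -/
def add (δ : Mem) (i : Key) : Mem :=
  ⟨insert i δ.set, match δ.idx with
    | none => some i
    | some w => some w⟩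

open Classical in
/-- The action of `#i` on a memory: the index `i` is reset to `*`. -/
noncomputable def sharp (δ : Mem) (i : Key) : Mem :=
  if δ.idx = some i then ⟨δ.set, none⟩ else δ

/-- The predicate `Cause(Γ_w, K, K')` of the instance. -/
def Cause (δ : Mem) (K K' : Set SKey) : Prop := K' = K ∪ {δ.idx}

/-- The predicate `Update(Γ_w, K, K')` of the instance. -/
def Update (δ : Mem) (K K' : Set SKey) : Prop := K' = K ∪ {δ.idx}

end Mem

/-! ## Reversible processes of the framework -/

/-- Reversible processes. Constructors `pastOut` and `pastInp` are executed prefixes, with their key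
`i` and contextual cause set `K`. A decorated standard process is a term without executed prefixes
all of whose restrictions carry the initial memory (see `ofProc`). -/
inductive RProc : Type
  | nil
  | out (b a : DAtom) (P : Proc DAtom)
  | inp (b : DAtom) (x : Var) (P : Proc DAtom)
  | pastOut (b a : DAtom) (i : Key) (K : Set SKey) (X : RProc)
  | pastInp (b : DAtom) (x : Var) (i : Key) (K : Set SKey) (X : RProc)
  | par (X Y : RProc)
  | res (a : Name) (δ : Mem) (X : RProc)

namespace RProc

/-- A decorated π-calculus process as a reversible process. -/
def ofProc : Proc DAtom → RProc
  | .nil => nil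
  | .out b a P => out b a P
  | .inp b x P => inp b x P
  | .par P Q => par (ofProc P) (ofProc Q)
  | .res a P => res a Mem.init (ofProc P)

/-- The initial reversible process of `P`: all restrictions are initialised and all names and
variables are decorated with `*`. -/
def initial (P : Proc Atom) : RProc := ofProc (P.map fun c => (c, none))

open Classical in
/-- The erasing function `φ`. -/
noncomputable def erase : RProc → Proc Atom
  | nil => .nil
  | out b a P => .out b.1 a.1 (P.map Prod.fst)
  | inp b x P => .inp b.1 x (P.map Prod.fst)
  | pastOut _ _ _ _ X => X.erase
  | pastInp _ _ _ _ X => X.erase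
  | par X Y => .par X.erase Y.erase
  | res a δ X => if δ.Empty then .res a X.erase else X.erase

/-- The set `key(X)` of communication keys. -/
def keys : RProc → Set Key
  | nil => ∅
  | out _ _ _ => ∅
  | inp _ _ _ => ∅
  | pastOut _ _ i _ X => {i} ∪ X.keys
  | pastInp _ _ i _ X => {i} ∪ X.keys
  | par X Y => X.keys ∪ Y.keys
  | res _ _ X => X.keys

/-- The substitution `X{v^i/x}`. An executed input no longer binds its variable. -/
noncomputable def subst (x : Var) (v : Atom) (i : Key) : RProc → RProc
  | nil => nil
  | out b a P => out (replaceD x v i b) (replaceD x v i a) (P.substBy x (replaceD x v i))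
  | inp b y P =>
      inp (replaceD x v i b) y (if y = x then P else P.substBy x (replaceD x v i))
  | pastOut b a k K X => pastOut (replaceD x v i b) (replaceD x v i a) k K (X.subst x v i)
  | pastInp b y k K X => pastInp (replaceD x v i b) y k K (X.subst x v i)
  | par X Y => par (X.subst x v i) (Y.subst x v i)
  | res a δ X => res a δ (X.subst x v i)

open Classical in
/-- The contextual cause update of the action with key `i`, from `K` to `K'`. -/
noncomputable def updateCause (i : Key) (K K' : Set SKey) : RProc → RProc
  | nil => nil
  | out b a P => out b a P
  | inp b x P => inp b x P
  | pastOut b a k L X =>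
      pastOut b a k (if k = i ∧ L = K then K' else L) (X.updateCause i K K')
  | pastInp b x k L X =>
      pastInp b x k (if k = i ∧ L = K then K' else L) (X.updateCause i K K')
  | par X Y => par (X.updateCause i K K') (Y.updateCause i K K')
  | res a δ X => res a δ (X.updateCause i K K')

/-- The operation `X_{#i}`. -/
noncomputable def sharp (i : Key) : RProc → RProc
  | nil => nil
  | out b a P => out b a P
  | inp b x P => inp b x P
  | pastOut b a k K X => pastOut b a k K (X.sharp i)
  | pastInp b x k K X => pastInp b x k K (X.sharp i)
  | par X Y => par (X.sharp i) (Y.sharp i)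
  | res a δ X => res a (δ.sharp i) (X.sharp i)

end RProc

/-! ## Forward transitions of the framework -/

/-- Actions `π` of the framework; `bout b a δ` is the output of `a`, restricted with memory `δ`. -/
inductive FAct : Type
  | out (b a : Atom)
  | inp (b : Atom) (x : Var)
  | bout (b : Atom) (a : Name) (δ : Mem)
  | tau

namespace FAct

/-- The subject of an action (none for a silent one). -/
def sub : FAct → Set Atom
  | out b _ => {b}
  | inp b _ => {b}
  | bout b _ _ => {b}
  | tau => ∅

/-- The names and variables that occur in an action. -/
def atoms : FAct → Set Atom
  | out b a => {b, a}
  | inp b x => {b, .var x}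
  | bout b a _ => {b, .name a}
  | tau => ∅

end FAct

/-- Labels `(i, K, j) : π` of the framework. -/
structure FLabel : Type where
  key : Key
  ctx : Set SKey
  inst : SKey
  act : FAct

/-- `K =_* j` -/
def StarEq (K : Set SKey) (j : SKey) : Prop := none ∈ K ∨ j = none ∨ K = {j}

/-- The forward transitions `X --(i,K,j):π--> X'` of the framework with memories `Γ_w`. The rules for
parallel composition come with their symmetric versions, and an executed prefix lets through every
action of its continuation. A restriction with empty memory is a binder, so it lets out
its name only on a different channel. -/
inductive FStep : RProc → FLabel → RProc → Prop
  | out1 (b a : DAtom) (P : Proc DAtom) (i : Key) (K : Set SKey) :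
      FStep (.out b a P) ⟨i, K, b.2, .out b.1 a.1⟩ (.pastOut b a i K (RProc.ofProc P))
  | in1 (b : DAtom) (x : Var) (P : Proc DAtom) (i : Key) (K : Set SKey) :
      FStep (.inp b x P) ⟨i, K, b.2, .inp b.1 x⟩ (.pastInp b x i K (RProc.ofProc P))
  | out2 (b a : DAtom) (k : Key) (L : Set SKey) (X X' : RProc) (μ : FLabel) :
      FStep X μ X' → μ.key ∉ (RProc.pastOut b a k L X).keys →
      FStep (.pastOut b a k L X) μ (.pastOut b a k L X')
  | in2 (b : DAtom) (x : Var) (k : Key) (L : Set SKey) (X X' : RProc) (μ : FLabel) :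
      FStep X μ X' → μ.key ∉ (RProc.pastInp b x k L X).keys →
      FStep (.pastInp b x k L X) μ (.pastInp b x k L X')
  | parL (X X' Y : RProc) (μ : FLabel) :
      FStep X μ X' → μ.key ∉ Y.keys → FStep (.par X Y) μ (.par X' Y)
  | parR (X Y Y' : RProc) (μ : FLabel) :
      FStep Y μ Y' → μ.key ∉ X.keys → FStep (.par X Y) μ (.par X Y')
  | res (a : Name) (δ : Mem) (X X' : RProc) (μ : FLabel) :
      FStep X μ X' → .name a ∉ μ.act.atoms → FStep (.res a δ X) μ (.res a δ X')
  | comL (X X' Y Y' : RProc) (i : Key) (K K' : Set SKey) (j j' : SKey) (b a : Atom) (x : Var) :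
      FStep X ⟨i, K, j, .out b a⟩ X' → FStep Y ⟨i, K', j', .inp b x⟩ Y' →
      StarEq K j' → StarEq K' j →
      FStep (.par X Y) ⟨i, {none}, none, .tau⟩ (.par X' (Y'.subst x a i))
  | comR (X X' Y Y' : RProc) (i : Key) (K K' : Set SKey) (j j' : SKey) (b a : Atom) (x : Var) :
      FStep X ⟨i, K, j, .out b a⟩ X' → FStep Y ⟨i, K', j', .inp b x⟩ Y' →
      StarEq K j' → StarEq K' j →
      FStep (.par Y X) ⟨i, {none}, none, .tau⟩ (.par (Y'.subst x a i) X')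
  | causeRef (a : Name) (δ : Mem) (X X' : RProc) (i : Key) (K K' : Set SKey) (j : SKey)
      (π : FAct) :
      FStep X ⟨i, K, j, π⟩ X' → .name a ∈ π.sub → ¬ δ.Empty → δ.Cause K K' →
      FStep (.res a δ X) ⟨i, K', j, π⟩ (.res a δ (X'.updateCause i K K'))
  | open (a : Name) (δ : Mem) (X X' : RProc) (i : Key) (K K' : Set SKey) (j : SKey)
      (b : Atom) (π : FAct) :
      FStep X ⟨i, K, j, π⟩ X' → (π = .out b (.name a) ∨ ∃ δ', π = .bout b a δ') →
      (δ.Empty → b ≠ .name a) → δ.Update K K' →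
      FStep (.res a δ X) ⟨i, K', j, .bout b a δ⟩ (.res a (δ.add i) (X'.updateCause i K K'))
  | closeL (X X' Y Y' : RProc) (i : Key) (K K' : Set SKey) (j j' : SKey) (b : Atom) (a : Name)
      (δ : Mem) (x : Var) :
      FStep X ⟨i, K, j, .bout b a δ⟩ X' → FStep Y ⟨i, K', j', .inp b x⟩ Y' →
      StarEq K j' → StarEq K' j →
      FStep (.par X Y) ⟨i, {none}, none, .tau⟩
        (.res a δ (.par (X'.sharp i) (Y'.subst x (.name a) i)))
  | closeR (X X' Y Y' : RProc) (i : Key) (K K' : Set SKey) (j j' : SKey) (b : Atom) (a : Name)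
      (δ : Mem) (x : Var) :
      FStep X ⟨i, K, j, .bout b a δ⟩ X' → FStep Y ⟨i, K', j', .inp b x⟩ Y' →
      StarEq K j' → StarEq K' j →
      FStep (.par Y X) ⟨i, {none}, none, .tau⟩
        (.res a δ (.par (Y'.subst x (.name a) i) (X'.sharp i)))

/-! ## Structural causes in the framework -/

/-- A vertex of a history graph: an occurrence of an executed prefix, given by its address in the
syntax tree, with its key. Two occurrences of the same key are different vertices. -/
abbrev Vertex := List Bool × Key

/-- All executed prefixes of a process. An address goes down through an executed prefix with
`false`, and to the left and right of a parallel composition with `false` and `true`. Hence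
a prefix occurs in the scope of another one iff the address of the latter is
a proper initial segment of the address of the former. -/
def RProc.occs : RProc → List Vertex
  | nil => []
  | out _ _ _ => []
  | inp _ _ _ => []
  | pastOut _ _ i _ X => ([], i) :: X.occs.map fun v => (false :: v.1, v.2)
  | pastInp _ _ i _ X => ([], i) :: X.occs.map fun v => (false :: v.1, v.2)
  | par X Y => (X.occs.map fun v => (false :: v.1, v.2)) ++ Y.occs.map fun v => (true :: v.1, v.2)
  | res _ _ X => X.occs

/-- Finite directed graphs on occurrences of keys. -/
structure HistGraph : Type where
  verts : Multiset Vertex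
  edge : Vertex → Vertex → Prop

/-- The graph `G` of the dependences between the keys in the history of `X`: edges lead from a prefix
to the prefixes in its scope, and in both directions between different vertices with the
same key. -/
def RProc.histGraph (X : RProc) : HistGraph where
  verts := X.occs
  edge v w := v ∈ X.occs ∧ w ∈ X.occs ∧ v ≠ w ∧ (v.1 <+: w.1 ∨ v.2 = w.2)

namespace HistGraph

/-- The vertices from which a path leads to a vertex with key `i`. -/
def Reaches (G : HistGraph) (i : Key) (v : Vertex) : Prop :=
  ∃ w ∈ G.verts, w.2 = i ∧ Relation.ReflTransGen G.edge v w

open Classical in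
/-- The graph `G(i)` made of all paths of `G` whose target has key `i`. -/
noncomputable def past (G : HistGraph) (i : Key) : HistGraph where
  verts := G.verts.filter (G.Reaches i)
  edge v w := G.edge v w ∧ G.Reaches i v ∧ G.Reaches i w

/-- The two vertices are connected by a bidirectional edge. -/
def Bidir (G : HistGraph) (v w : Vertex) : Prop := G.edge v w ∧ G.edge w v

/-- Vertices after contraction of the bidirectional edges: an old key, or a vertex `τ_l`, which is
named here by the set of the vertices that were merged into it. -/
inductive CVertex : Type
  | key (k : Key)
  | tau (l : Set Vertex)

open Classical in
/-- The vertex that a vertex becomes when all bidirectional edges are contracted. -/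
noncomputable def contract (G : HistGraph) (v : Vertex) : CVertex :=
  if ∃ w, G.Bidir v w then .tau {w | Relation.ReflTransGen G.Bidir v w} else .key v.2

/-- The vertex set `V'` of the contracted graph. -/
def contractedVerts (G : HistGraph) : Set CVertex := {c | ∃ v ∈ G.verts, G.contract v = c}

end HistGraph

/-- The multiset `K_F = V(i) \ {i}` of the structural causes of the action with key `i` in the
history of `X`. -/
noncomputable def RProc.structCauses (X : RProc) (i : Key) : Multiset Key :=
  ((X.histGraph.past i).verts.map Prod.snd).filter (· ≠ i)

/-- The algorithm `Rem` (removing keys from a set), applied to the multiset `KF` of structural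
causes of the action with key `i` in the history of `X`: it contracts the bidirectional edges of
`G(i)` and drops the vertices `τ_l`. -/
def RProc.Rem (X : RProc) (i : Key) (KF : Multiset Key) : Set Key :=
  {k | k ∈ KF ∧ HistGraph.CVertex.key k ∈ (X.histGraph.past i).contractedVerts}

/-- Forward transitions, annotated with the multiset of structural causes of the executed action. -/
def FStepK (X : RProc) (KF : Multiset Key) (μ : FLabel) (X' : RProc) : Prop :=
  FStep X μ X' ∧ KF = X'.structCauses μ.key

/-! ## The causal semantics of Boreale and Sangiorgi, in late style -/

/-- Causal processes `A ::= P | K :: A | A | A | ν a A`, where `P` is a π-calculus process. -/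
inductive CProc : Type
  | nil
  | out (b a : Atom) (P : Proc Atom)
  | inp (b : Atom) (x : Var) (P : Proc Atom)
  | par (A B : CProc)
  | res (a : Name) (A : CProc)
  | cause (K : Set Key) (A : CProc)

namespace CProc

/-- A π-calculus process as a causal process. -/
def ofProc : Proc Atom → CProc
  | .nil => nil
  | .out b a P => out b a P
  | .inp b x P => inp b x P
  | .par P Q => par (ofProc P) (ofProc Q)
  | .res a P => res a (ofProc P)

/-- The erasing function `λ`. -/
def erase : CProc → Proc Atom
  | nil => .nil
  | out b a P => .out b a P
  | inp b x P => .inp b x P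
  | par A B => .par A.erase B.erase
  | res a A => .res a A.erase
  | cause _ A => A.erase

/-- The keys that occur in the cause sets of a causal process. -/
def keys : CProc → Set Key
  | nil => ∅
  | out _ _ _ => ∅
  | inp _ _ _ => ∅
  | par A B => A.keys ∪ B.keys
  | res _ A => A.keys
  | cause K A => K ∪ A.keys

/-- Free names and variables. -/
def free (A : CProc) : Set Atom := A.erase.free

/-- The substitution `A{v/x}`. -/
noncomputable def subst (x : Var) (v : Atom) : CProc → CProc
  | nil => nil
  | out b a P => out (Atom.replace x v b) (Atom.replace x v a) (P.subst x v)
  | inp b y P => inp (Atom.replace x v b) y (if y = x then P else P.subst x v)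
  | par A B => par (A.subst x v) (B.subst x v)
  | res a A => res a (A.subst x v)
  | cause K A => cause K (A.subst x v)

/-- The replacement `A[k ⇝ L]` of the cause `k` by the causes in `L`, in all cause sets. -/
def replaceCause (k : Key) (L : Set Key) : CProc → CProc
  | nil => nil
  | out b a P => out b a P
  | inp b x P => inp b x P
  | par A B => par (A.replaceCause k L) (B.replaceCause k L)
  | res a A => res a (A.replaceCause k L)
  | cause K A => cause {m | (m ∈ K ∧ m ≠ k) ∨ (k ∈ K ∧ m ∈ L)} (A.replaceCause k L)

end CProc

/-- Visible actions: free output, bound output, input. -/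
inductive BAct : Type
  | out (b a : Atom)
  | bout (b : Atom) (a : Name)
  | inp (b : Atom) (x : Var)

/-- Labels `ζ`: a visible action with its key, or a silent action. -/
inductive BLabel : Type
  | vis (k : Key) (π : BAct)
  | tau

namespace BLabel

def keys : BLabel → Set Key
  | vis k _ => {k}
  | tau => ∅

/-- The names and variables that occur in a label. -/
def atoms : BLabel → Set Atom
  | vis _ (.out b a) => {b, a}
  | vis _ (.bout b a) => {b, .name a}
  | vis _ (.inp b x) => {b, .var x}
  | tau => ∅

/-- Bound names and variables of a label. -/
def bound : BLabel → Set Atom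
  | vis _ (.out _ _) => ∅
  | vis _ (.bout _ a) => {.name a}
  | vis _ (.inp _ x) => {.var x}
  | tau => ∅

end BLabel

/-- The late causal transitions `A --K,ζ--> A'`. For a visible label `ζ = k : π`, the set `K` is the
cause set of the action. A silent label shows neither a key nor causes; the set `K` that is kept
next to it here is the union of the cause sets of the two actions that synchronise, and forgetting
it gives the silent transitions of the original semantics, because no rule depends on it. -/
inductive BStep : CProc → Set Key → BLabel → CProc → Prop
  | out (b a : Atom) (P : Proc Atom) (k : Key) :
      BStep (.out b a P) ∅ (.vis k (.out b a)) (.cause {k} (CProc.ofProc P))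
  | inp (b : Atom) (x : Var) (P : Proc Atom) (k : Key) :
      BStep (.inp b x P) ∅ (.vis k (.inp b x)) (.cause {k} (CProc.ofProc P))
  | cau (L : Set Key) (A A' : CProc) (K : Set Key) (ζ : BLabel) :
      BStep A K ζ A' → Disjoint ζ.keys L → BStep (.cause L A) (L ∪ K) ζ (.cause L A')
  | parL (A A' B : CProc) (K : Set Key) (ζ : BLabel) :
      BStep A K ζ A' → Disjoint ζ.keys B.keys → Disjoint ζ.bound B.free →
      BStep (.par A B) K ζ (.par A' B)
  | parR (A B B' : CProc) (K : Set Key) (ζ : BLabel) :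
      BStep B K ζ B' → Disjoint ζ.keys A.keys → Disjoint ζ.bound A.free →
      BStep (.par A B) K ζ (.par A B')
  | res (a : Name) (A A' : CProc) (K : Set Key) (ζ : BLabel) :
      BStep A K ζ A' → .name a ∉ ζ.atoms → BStep (.res a A) K ζ (.res a A')
  | open (a : Name) (b : Atom) (A A' : CProc) (K : Set Key) (k : Key) :
      BStep A K (.vis k (.out b (.name a))) A' → b ≠ .name a →
      BStep (.res a A) K (.vis k (.bout b a)) A'
  | comL (A A' B B' : CProc) (K L : Set Key) (k : Key) (b a : Atom) (x : Var) :
      BStep A K (.vis k (.out b a)) A' → BStep B L (.vis k (.inp b x)) B' →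
      BStep (.par A B) (K ∪ L) .tau
        (.par (A'.replaceCause k L) ((B'.subst x a).replaceCause k K))
  | comR (A A' B B' : CProc) (K L : Set Key) (k : Key) (b a : Atom) (x : Var) :
      BStep A K (.vis k (.out b a)) A' → BStep B L (.vis k (.inp b x)) B' →
      BStep (.par B A) (K ∪ L) .tau
        (.par ((B'.subst x a).replaceCause k K) (A'.replaceCause k L))
  | closeL (A A' B B' : CProc) (K L : Set Key) (k : Key) (b : Atom) (a : Name) (x : Var) :
      BStep A K (.vis k (.bout b a)) A' → BStep B L (.vis k (.inp b x)) B' → .name a ∉ B.free →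
      BStep (.par A B) (K ∪ L) .tau
        (.res a (.par (A'.replaceCause k L) ((B'.subst x (.name a)).replaceCause k K)))
  | closeR (A A' B B' : CProc) (K L : Set Key) (k : Key) (b : Atom) (a : Name) (x : Var) :
      BStep A K (.vis k (.bout b a)) A' → BStep B L (.vis k (.inp b x)) B' → .name a ∉ B.free →
      BStep (.par B A) (K ∪ L) .tau
        (.res a (.par ((B'.subst x (.name a)).replaceCause k K) (A'.replaceCause k L)))

open Classical in
/-- The function `γ` from labels of the framework to labels of the causal semantics. -/
noncomputable def gamma (μ : FLabel) : BLabel :=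
  match μ.act with
  | .out b a => .vis μ.key (.out b a)
  | .inp b x => .vis μ.key (.inp b x)
  | .bout b a δ => .vis μ.key (if δ.Empty then .bout b a else .out b (.name a))
  | .tau => .tau

end PiCausal

open PiCausal

namespace PiCausal

/-! ## Causal processes read off reversible processes -/

/-! The two semantics share one syntax tree. If every executed prefix of a reversible process `X` is
given a set of keys by an assignment `κ`, then `X.toC κ` is a causal process: a prefix becomes a
cause operator, and a restriction with non-empty memory disappears. Both computations are followed
through a relation of the form `A = X.toC κ`, which already yields equality of the erasures
(`RProc.erase_toC`).

A visible transition adds one vertex to the history, whose own cause set is the singleton of its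
causal key. A silent one adds two vertices with the same key, whose own cause sets `L` and `K` are
the causes accumulated above the partner. So the causes at and above either new vertex form `K ∪ L`.
`Ext` records this growth, and it is all that the causal bookkeeping needs to know about a
transition.

The invariant on causes is `IsHistory`: the cause sets at and above a vertex collect the keys of
those vertices of its past in the history graph whose key occurs only once. New vertices lie above
no old one and have a fresh key, so old pasts do not change, and the past of a new vertex is the
union of the pasts above the new addresses (`Ext.pastKeys_new`). Bidirectional edges join exactly
the vertices that share a key, that is, the two halves of a silent action. Hence `Rem` keeps the
keys that occur once, and on the executed action it returns the causal cause set
(`Ext.rem_structCauses`).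

Transitions are matched by `FStep.exists_bstep_vis` and `FStep.exists_bstep_tau` in one direction
and by `RProc.exists_fstep_vis` and `RProc.exists_fstep_tau` in the other. An extrusion through a
non-empty memory counts as a free output, so a reversible Close may be a causal communication. For
this to be consistent no extruded name may be bound again, which is the invariant `RProc.WF`.
Contextual causes never obstruct a transition, because they can always be chosen to contain `*`.

A causal silent label has no key, so the reversible process must invent one that no later visible
action uses. As the whole trace is given, silent keys are taken above all of its visible keys
(`KeysBound`). -/

/-- Assignments of cause sets to addresses of executed prefixes. -/
abbrev Causes := List Bool → Set Key

/-- The assignment on a node with the given value at the root and on the two subtrees. -/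
def Causes.glue (S : Set Key) (f g : Causes) : Causes
  | [] => S
  | false :: l => f l
  | true :: l => g l

open Classical in
/-- The causal process whose executed prefixes are those of `X`, with cause sets given by `κ`. -/
noncomputable def RProc.toC : RProc → Causes → CProc
  | .nil, _ => .nil
  | .out b a P, _ => .out b.1 a.1 (P.map Prod.fst)
  | .inp b x P, _ => .inp b.1 x (P.map Prod.fst)
  | .pastOut _ _ _ _ X, κ => .cause (κ []) (X.toC fun l => κ (false :: l))
  | .pastInp _ _ _ _ X, κ => .cause (κ []) (X.toC fun l => κ (false :: l))
  | .par X Y, κ => .par (X.toC fun l => κ (false :: l)) (Y.toC fun l => κ (true :: l))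
  | .res a δ X, κ => if δ.Empty then .res a (X.toC κ) else X.toC κ

theorem CProc.erase_ofProc (P : Proc Atom) : (CProc.ofProc P).erase = P := by
  induction P <;> simp_all [CProc.ofProc, CProc.erase]

theorem Mem.init_empty : Mem.init.Empty := ⟨rfl, rfl⟩

theorem RProc.toC_ofProc (P : Proc DAtom) (κ : Causes) :
    (RProc.ofProc P).toC κ = CProc.ofProc (P.map Prod.fst) := by
  induction P generalizing κ <;>
    simp_all [RProc.ofProc, RProc.toC, CProc.ofProc, Proc.map, Mem.init_empty]

/-- Cause operators are invisible to erasure, and `toC` drops the same restrictions as `φ`. Besides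
giving the equality of erasures along traces, this transfers facts on erased causal processes to
reversible ones. -/
theorem RProc.erase_toC (X : RProc) (κ : Causes) : (X.toC κ).erase = X.erase := by
  induction X generalizing κ with
  | res a δ X ih =>
    by_cases h : δ.Empty <;> simp [RProc.toC, RProc.erase, CProc.erase, h, ih]
  | _ => simp_all [RProc.toC, RProc.erase, CProc.erase]

theorem RProc.erase_ofProc (P : Proc DAtom) : (RProc.ofProc P).erase = P.map Prod.fst := by
  rw [← RProc.erase_toC _ (fun _ => ∅), RProc.toC_ofProc, CProc.erase_ofProc]

theorem RProc.toC_initial (P : Proc Atom) (κ : Causes) :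
    (RProc.initial P).toC κ = CProc.ofProc P := by
  rw [RProc.initial, RProc.toC_ofProc]
  congr 1
  induction P <;> simp_all [Proc.map]

theorem RProc.occs_ofProc (P : Proc DAtom) : (RProc.ofProc P).occs = [] := by
  induction P <;> simp_all [RProc.ofProc, RProc.occs]

theorem RProc.mem_keys {X : RProc} {k : Key} : k ∈ X.keys ↔ ∃ u ∈ X.occs, u.2 = k := by
  induction X with
  | par X Y ihX ihY =>
    simp [RProc.keys, RProc.occs, ihX, ihY, or_and_right, exists_or]
  | _ => simp_all [RProc.keys, RProc.occs, eq_comm]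

theorem RProc.keys_toC (X : RProc) (κ : Causes) (m : Key) :
    m ∈ (X.toC κ).keys ↔ ∃ u ∈ X.occs, m ∈ κ u.1 := by
  induction X generalizing κ with
  | par X Y ihX ihY =>
    simp [RProc.toC, CProc.keys, RProc.occs, ihX, ihY, or_and_right, exists_or]
  | res a δ X ih =>
    by_cases h : δ.Empty <;> simp [RProc.toC, RProc.occs, CProc.keys, h, ih]
  | _ => simp_all [RProc.toC, CProc.keys, RProc.occs]

/-! ### Operations on reversible processes -/

theorem replaceD_fst (x : Var) (v : Atom) (i : Key) (c : DAtom) :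
    (replaceD x v i c).1 = Atom.replace x v c.1 := by
  unfold replaceD Atom.replace; split_ifs <;> rfl

theorem Proc.map_substBy (P : Proc DAtom) (x : Var) (v : Atom) (i : Key) :
    (P.substBy x (replaceD x v i)).map Prod.fst = (P.map Prod.fst).subst x v := by
  unfold Proc.subst
  induction P with
  | inp b y P ih =>
    by_cases hy : y = x <;> simp [Proc.substBy, Proc.map, replaceD_fst, hy, ih]
  | _ => simp_all [Proc.substBy, Proc.map, replaceD_fst]

theorem RProc.toC_subst (X : RProc) (κ : Causes) (x : Var) (v : Atom) (i : Key) :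
    (X.subst x v i).toC κ = (X.toC κ).subst x v := by
  induction X generalizing κ with
  | inp b y P =>
    by_cases hy : y = x <;>
      simp [RProc.subst, RProc.toC, CProc.subst, replaceD_fst, hy, Proc.map_substBy]
  | res a δ X ih =>
    by_cases h : δ.Empty <;> simp [RProc.subst, RProc.toC, CProc.subst, h, ih]
  | _ => simp_all [RProc.subst, RProc.toC, CProc.subst, replaceD_fst, Proc.map_substBy]

/-- Contextual causes do not enter `toC`; only structural causes are compared. -/
theorem RProc.toC_updateCause (X : RProc) (κ : Causes) (i : Key) (K K' : Set SKey) :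
    (X.updateCause i K K').toC κ = X.toC κ := by
  induction X generalizing κ <;> simp_all [RProc.updateCause, RProc.toC]

theorem RProc.occs_subst (X : RProc) (x : Var) (v : Atom) (i : Key) :
    (X.subst x v i).occs = X.occs := by
  induction X <;> simp_all [RProc.subst, RProc.occs]

theorem RProc.occs_updateCause (X : RProc) (i : Key) (K K' : Set SKey) :
    (X.updateCause i K K').occs = X.occs := by
  induction X <;> simp_all [RProc.updateCause, RProc.occs]

theorem RProc.occs_sharp (X : RProc) (i : Key) : (X.sharp i).occs = X.occs := by
  induction X <;> simp_all [RProc.sharp, RProc.occs]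

/-- The cause sets that result from `S` when the cause `k` is replaced by `L`. -/
def replaceKey (k : Key) (L S : Set Key) : Set Key := {m | (m ∈ S ∧ m ≠ k) ∨ (k ∈ S ∧ m ∈ L)}

/-- The exchange of causes in a synchronisation thus becomes a pointwise operation on assignments.
-/
theorem RProc.toC_replaceCause (X : RProc) (κ : Causes) (k : Key) (L : Set Key) :
    (X.toC κ).replaceCause k L = X.toC fun l => replaceKey k L (κ l) := by
  induction X generalizing κ with
  | res a δ X ih =>
    by_cases h : δ.Empty <;> simp [RProc.toC, CProc.replaceCause, h, ih]
  | _ => simp_all [RProc.toC, CProc.replaceCause, replaceKey]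

/-! ## Well-formed reversible processes -/

/-- A non-empty index comes with a non-empty set. -/
def Mem.Ok (δ : Mem) : Prop := δ.set = ∅ → δ.idx = none

theorem Mem.not_empty_add (δ : Mem) (i : Key) : ¬ (δ.add i).Empty := by
  rintro ⟨h, -⟩
  exact (Set.insert_nonempty _ _).ne_empty h

theorem Mem.ok_add (δ : Mem) (i : Key) : (δ.add i).Ok := fun h =>
  absurd h (Set.insert_nonempty _ _).ne_empty

theorem Mem.ok_sharp {δ : Mem} (i : Key) (h : δ.Ok) : (δ.sharp i).Ok := by
  unfold Mem.sharp; split_ifs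
  · exact fun _ => rfl
  · exact h

/-- Without `Ok`, resetting the index of a memory with empty set would make it empty and turn an
invisible restriction into a binder. -/
theorem Mem.empty_sharp {δ : Mem} (i : Key) (h : δ.Ok) : (δ.sharp i).Empty ↔ δ.Empty := by
  unfold Mem.sharp; split_ifs with hi
  · constructor
    · rintro ⟨h1, -⟩
      exact ⟨h1, h h1⟩
    · rintro ⟨-, h2⟩
      simp [h2] at hi
  · rfl

/-- The names of all restrictions, with empty or non-empty memory, that occur in a process. -/
def RProc.resNames : RProc → Set Name
  | .nil => ∅
  | .out _ _ P => {a | .name a ∈ (P.map Prod.fst).binders}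
  | .inp _ _ P => {a | .name a ∈ (P.map Prod.fst).binders}
  | .pastOut _ _ _ _ X => X.resNames
  | .pastInp _ _ _ _ X => X.resNames
  | .par X Y => X.resNames ∪ Y.resNames
  | .res a _ X => {a} ∪ X.resNames

/-- A name with a restriction with non-empty memory has no binder below that restriction or beside
it in a parallel composition. -/
def RProc.WF : RProc → Prop
  | .nil => True
  | .out _ _ _ => True
  | .inp _ _ _ => True
  | .pastOut _ _ _ _ X => X.WF
  | .pastInp _ _ _ _ X => X.WF
  | .par X Y => X.WF ∧ Y.WF ∧ (∀ a ∈ X.resNames, .name a ∉ Y.erase.binders) ∧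
      ∀ a ∈ Y.resNames, .name a ∉ X.erase.binders
  | .res a δ X => X.WF ∧ δ.Ok ∧ (¬ δ.Empty → .name a ∉ X.erase.binders)

/-! ### Invariance of binders and well-formedness under substitution, cause update and index reset
-/

theorem Proc.binders_substBy (P : Proc Atom) (x : Var) (f : Atom → Atom) :
    (P.substBy x f).binders = P.binders := by
  induction P with
  | inp b y P ih => by_cases hy : y = x <;> simp [Proc.substBy, Proc.binders, hy, ih]
  | _ => simp_all [Proc.substBy, Proc.binders]

theorem Proc.binders_subst (P : Proc Atom) (x : Var) (v : Atom) :
    (P.subst x v).binders = P.binders := P.binders_substBy x _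

theorem CProc.erase_subst (A : CProc) (x : Var) (v : Atom) :
    (A.subst x v).erase = A.erase.subst x v := by
  induction A with
  | _ => simp_all [CProc.subst, CProc.erase, Proc.subst, Proc.substBy]

theorem CProc.erase_replaceCause (A : CProc) (k : Key) (L : Set Key) :
    (A.replaceCause k L).erase = A.erase := by
  induction A <;> simp_all [CProc.replaceCause, CProc.erase]

theorem RProc.binders_erase_subst (X : RProc) (x : Var) (v : Atom) (i : Key) :
    (X.subst x v i).erase.binders = X.erase.binders := by
  rw [← RProc.erase_toC _ (fun _ => ∅), RProc.toC_subst, CProc.erase_subst, Proc.binders_subst,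
    RProc.erase_toC]

theorem RProc.erase_updateCause (X : RProc) (i : Key) (K K' : Set SKey) :
    (X.updateCause i K K').erase = X.erase := by
  rw [← RProc.erase_toC _ (fun _ => ∅), RProc.toC_updateCause, RProc.erase_toC]

theorem RProc.WF.toC_sharp {X : RProc} (h : X.WF) (i : Key) (κ : Causes) :
    (X.sharp i).toC κ = X.toC κ := by
  induction X generalizing κ with
  | par X Y ihX ihY => simp [RProc.sharp, RProc.toC, ihX h.1, ihY h.2.1]
  | res a δ X ih =>
    have he := Mem.empty_sharp i h.2.1
    by_cases hδ : δ.Empty <;> simp [RProc.sharp, RProc.toC, he, hδ, ih h.1]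
  | pastOut b a k K X ih => simp [RProc.sharp, RProc.toC, ih h]
  | pastInp b x k K X ih => simp [RProc.sharp, RProc.toC, ih h]
  | _ => simp [RProc.sharp, RProc.toC]

theorem RProc.WF.erase_sharp {X : RProc} (h : X.WF) (i : Key) : (X.sharp i).erase = X.erase := by
  rw [← RProc.erase_toC _ (fun _ => ∅), h.toC_sharp, RProc.erase_toC]

theorem RProc.resNames_subst (X : RProc) (x : Var) (v : Atom) (i : Key) :
    (X.subst x v i).resNames = X.resNames := by
  induction X with
  | inp b y P =>
    by_cases hy : y = x <;>
      simp [RProc.subst, RProc.resNames, hy, Proc.map_substBy, Proc.binders_subst]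
  | _ => simp_all [RProc.subst, RProc.resNames, Proc.map_substBy, Proc.binders_subst]

theorem RProc.resNames_updateCause (X : RProc) (i : Key) (K K' : Set SKey) :
    (X.updateCause i K K').resNames = X.resNames := by
  induction X <;> simp_all [RProc.updateCause, RProc.resNames]

theorem RProc.resNames_sharp (X : RProc) (i : Key) : (X.sharp i).resNames = X.resNames := by
  induction X <;> simp_all [RProc.sharp, RProc.resNames]

theorem RProc.WF.subst {X : RProc} (h : X.WF) (x : Var) (v : Atom) (i : Key) :
    (X.subst x v i).WF := by
  induction X with
  | par X Y ihX ihY =>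
    simpa [RProc.subst, RProc.WF, RProc.resNames_subst, RProc.binders_erase_subst, ihX h.1,
      ihY h.2.1] using h.2.2
  | res a δ X ih => simpa [RProc.subst, RProc.WF, RProc.binders_erase_subst, ih h.1] using h.2
  | pastOut b a k K X ih => exact ih h
  | pastInp b x k K X ih => exact ih h
  | _ => trivial

theorem RProc.WF.updateCause {X : RProc} (h : X.WF) (i : Key) (K K' : Set SKey) :
    (X.updateCause i K K').WF := by
  induction X with
  | par X Y ihX ihY =>
    simpa [RProc.updateCause, RProc.WF, RProc.resNames_updateCause, RProc.erase_updateCause,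
      ihX h.1, ihY h.2.1] using h.2.2
  | res a δ X ih =>
    simpa [RProc.updateCause, RProc.WF, RProc.erase_updateCause, ih h.1] using h.2
  | pastOut b a k K X ih => exact ih h
  | pastInp b x k K X ih => exact ih h
  | _ => trivial

theorem RProc.WF.sharp {X : RProc} (h : X.WF) (i : Key) : (X.sharp i).WF := by
  induction X with
  | par X Y ihX ihY =>
    simpa [RProc.sharp, RProc.WF, RProc.resNames_sharp, h.1.erase_sharp, h.2.1.erase_sharp,
      ihX h.1, ihY h.2.1] using h.2.2
  | res a δ X ih =>
    simpa [RProc.sharp, RProc.WF, h.1.erase_sharp, ih h.1, Mem.empty_sharp i h.2.1,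
      Mem.ok_sharp i h.2.1] using h.2.2
  | pastOut b a k K X ih => exact ih h
  | pastInp b x k K X ih => exact ih h
  | _ => trivial

theorem RProc.resNames_ofProc (P : Proc DAtom) :
    (RProc.ofProc P).resNames = {a | .name a ∈ (P.map Prod.fst).binders} := by
  induction P with
  | par P Q ihP ihQ =>
    ext; simp [RProc.ofProc, RProc.resNames, Proc.map, Proc.binders, ihP, ihQ]
  | res a P ih => ext; simp [RProc.ofProc, RProc.resNames, Proc.map, Proc.binders, ih]
  | _ => simp [RProc.ofProc, RProc.resNames, Proc.map, Proc.binders]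

theorem RProc.wf_ofProc {P : Proc DAtom} (h : (P.map Prod.fst).binders.Nodup) :
    (RProc.ofProc P).WF := by
  induction P with
  | par P Q ihP ihQ =>
    simp only [Proc.map, Proc.binders, List.nodup_append] at h
    refine ⟨ihP h.1, ihQ h.2.1, ?_, ?_⟩
    · intro a ha hb
      rw [RProc.resNames_ofProc] at ha
      rw [RProc.erase_ofProc] at hb
      exact h.2.2 _ ha _ hb rfl
    · intro a ha hb
      rw [RProc.resNames_ofProc] at ha
      rw [RProc.erase_ofProc] at hb
      exact h.2.2 _ hb _ ha rfl
  | res a P ih =>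
    simp only [Proc.map, Proc.binders, List.nodup_cons] at h
    exact ⟨ih h.2, fun _ => rfl, fun hne => absurd Mem.init_empty hne⟩
  | _ => trivial

theorem RProc.binders_erase_res_subset (a : Name) (δ : Mem) (X : RProc) {c : Atom}
    (hc : c ∈ X.erase.binders) : c ∈ (RProc.res a δ X).erase.binders := by
  by_cases h : δ.Empty <;> simp [RProc.erase, h, Proc.binders, hc]

theorem RProc.nodup_of_res {a : Name} {δ : Mem} {X : RProc}
    (h : (RProc.res a δ X).erase.binders.Nodup) : X.erase.binders.Nodup := by
  by_cases hδ : δ.Empty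
  · simp only [RProc.erase, hδ, if_true, Proc.binders, List.nodup_cons] at h
    exact h.2
  · simpa [RProc.erase, hδ] using h

theorem RProc.WF.not_mem_binders {a : Name} {δ : Mem} {X : RProc} (hw : (RProc.res a δ X).WF)
    (h : (RProc.res a δ X).erase.binders.Nodup) : .name a ∉ X.erase.binders := by
  by_cases hδ : δ.Empty
  · simp only [RProc.erase, hδ, if_true, Proc.binders, List.nodup_cons] at h
    exact h.1
  · exact hw.2.2 hδ

/-! ### Preservation of well-formedness by reversible transitions -/

/-- The properties of a transition from which the preservation of well-formedness follows. -/
structure StepWF (X : RProc) (μ : FLabel) (X' : RProc) : Prop where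
  wf : X'.WF
  resNames : X'.resNames ⊆ X.resNames
  binders : ∀ c ∈ X'.erase.binders, c ∈ X.erase.binders
  inp : ∀ b x, μ.act = .inp b x → .var x ∈ X.erase.binders
  bout : ∀ b a δ, μ.act = .bout b a δ → a ∈ X.resNames ∧ .name a ∉ X'.erase.binders ∧ δ.Ok ∧
    (δ.Empty → .name a ∈ X.erase.binders)

theorem StepWF.com {X X' Y Y' : RProc} {μ ν : FLabel} {i : Key} {x : Var} {v : Atom}
    (hX : StepWF X μ X') (hY : StepWF Y ν Y') (h : (RProc.par X Y).WF) :
    (RProc.par X' (Y'.subst x v i)).WF ∧ (RProc.par (Y'.subst x v i) X').WF := by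
  have h1 : ∀ a ∈ X'.resNames, .name a ∉ Y'.erase.binders := fun a ha hb =>
    h.2.2.1 a (hX.resNames ha) (hY.binders _ hb)
  have h2 : ∀ a ∈ Y'.resNames, .name a ∉ X'.erase.binders := fun a ha hb =>
    h.2.2.2 a (hY.resNames ha) (hX.binders _ hb)
  constructor <;>
    simpa [RProc.WF, hX.wf, hY.wf.subst, RProc.resNames_subst, RProc.binders_erase_subst]
      using ⟨by assumption, by assumption⟩

/-- Serves both Cause Ref, where `δ' = δ` and the action is unchanged, and Open, where `δ' = δ.add
i` and the action becomes an extrusion of `a`. In both the resulting memory is non-empty, so `a`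
must not be bound below it. -/
theorem StepWF.res_update {X X' : RProc} {μ ν : FLabel} {a : Name} {δ δ' : Mem} {i : Key}
    {K K' : Set SKey} (hX : StepWF X μ X') (hw : (RProc.res a δ X).WF)
    (hnd : (RProc.res a δ X).erase.binders.Nodup) (hok : δ'.Ok) (hne : ¬ δ'.Empty)
    (hi : ∀ b x, ν.act = .inp b x → μ.act = .inp b x)
    (ho : ∀ b c ε, ν.act = .bout b c ε → (c = a ∧ ε = δ) ∨ ∃ b', μ.act = .bout b' c ε) :
    StepWF (.res a δ X) ν (.res a δ' (X'.updateCause i K K')) where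
  wf := ⟨hX.wf.updateCause i K K', hok, fun _ h => by
    rw [RProc.erase_updateCause] at h
    exact hw.not_mem_binders hnd (hX.binders _ h)⟩
  resNames := by
    simpa [RProc.resNames, RProc.resNames_updateCause] using
      Set.insert_subset_insert hX.resNames
  binders c hc := by
    simp only [RProc.erase, hne, if_false, RProc.erase_updateCause] at hc
    exact RProc.binders_erase_res_subset _ _ _ (hX.binders _ hc)
  inp b x h := RProc.binders_erase_res_subset _ _ _ (hX.inp b x (hi b x h))
  bout b c ε h := by
    simp only [RProc.erase, hne, if_false, RProc.erase_updateCause]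
    rcases ho b c ε h with ⟨rfl, rfl⟩ | ⟨b', h'⟩
    · exact ⟨Or.inl rfl, fun h' => hw.not_mem_binders hnd (hX.binders _ h'), hw.2.1,
        fun he => by simp [he, Proc.binders]⟩
    · have := hX.bout _ _ _ h'
      exact ⟨Or.inr this.1, this.2.1, this.2.2.1, fun he =>
        RProc.binders_erase_res_subset _ _ _ (this.2.2.2 he)⟩

/-- The restriction created by Close may have non-empty memory. It is harmless: `a` is restricted in
`X`, hence not a binder of `Y`, and after the extrusion it is no binder of `X'` either. -/
theorem StepWF.close {X X' Y Y' : RProc} {μ ν : FLabel} {i : Key} {x : Var} {b : Atom}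
    {a : Name} {δ : Mem} (hX : StepWF X μ X') (hY : StepWF Y ν Y') (h : (RProc.par X Y).WF)
    (hμ : μ.act = .bout b a δ) :
    (RProc.res a δ (.par (X'.sharp i) (Y'.subst x (.name a) i))).WF ∧
      (RProc.res a δ (.par (Y'.subst x (.name a) i) (X'.sharp i))).WF := by
  have h0 := hX.bout _ _ _ hμ
  have hs : StepWF X μ (X'.sharp i) :=
    ⟨hX.wf.sharp i, by simpa [RProc.resNames_sharp] using hX.resNames,
      by simpa [hX.wf.erase_sharp] using hX.binders, hX.inp,
      by simpa [hX.wf.erase_sharp] using hX.bout⟩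
  have hY' : Atom.name a ∉ Y'.erase.binders := fun hb => h.2.2.1 a h0.1 (hY.binders _ hb)
  have hc := hs.com (x := x) (v := .name a) (i := i) hY h
  exact ⟨⟨hc.1, h0.2.2.1, by
      simp [RProc.erase, Proc.binders, hX.wf.erase_sharp, RProc.binders_erase_subst, h0.2.1, hY']⟩,
    ⟨hc.2, h0.2.2.1, by
      simp [RProc.erase, Proc.binders, hX.wf.erase_sharp, RProc.binders_erase_subst, h0.2.1, hY']⟩⟩

/-- Transitions create no binders and no new restricted names. Distinctness of the binders enters at
a restriction, where it shows that the restricted name has no further binder below. -/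
theorem FStep.stepWF {X X' : RProc} {μ : FLabel} (h : FStep X μ X') (hw : X.WF)
    (hnd : X.erase.binders.Nodup) : StepWF X μ X' := by
  induction h with
  | out1 b a P i K =>
    exact ⟨RProc.wf_ofProc hnd, by simp [RProc.resNames, RProc.resNames_ofProc],
      by simp [RProc.erase, RProc.erase_ofProc, Proc.binders], by simp, by simp⟩
  | in1 b x P i K =>
    simp only [RProc.erase, Proc.binders, List.nodup_cons] at hnd
    refine ⟨RProc.wf_ofProc hnd.2, by simp [RProc.resNames, RProc.resNames_ofProc],
      ?_, ?_, by simp⟩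
    · intro c hc
      simp only [RProc.erase, RProc.erase_ofProc] at hc
      simp [RProc.erase, Proc.binders, hc]
    · rintro b' x' h
      simp only [FAct.inp.injEq] at h
      simp [RProc.erase, Proc.binders, h.2]
  | out2 b a k L X X' μ h hk ih =>
    have := ih hw hnd
    exact ⟨this.wf, this.resNames, this.binders, this.inp, this.bout⟩
  | in2 b x k L X X' μ h hk ih =>
    have := ih hw hnd
    exact ⟨this.wf, this.resNames, this.binders, this.inp, this.bout⟩
  | parL X X' Y μ h hk ih =>
    simp only [RProc.erase, Proc.binders, List.nodup_append] at hnd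
    have := ih hw.1 hnd.1
    refine ⟨⟨this.wf, hw.2.1, fun a ha => hw.2.2.1 a (this.resNames ha),
      fun a ha hb => hw.2.2.2 a ha (this.binders _ hb)⟩,
      Set.union_subset_union_left _ this.resNames, ?_, ?_, ?_⟩
    · simp only [RProc.erase, Proc.binders, List.mem_append]
      exact fun c => Or.imp_left (this.binders c)
    · intro b x h
      simp [RProc.erase, Proc.binders, this.inp b x h]
    · intro b a δ h
      have h0 := this.bout b a δ h
      simp only [RProc.erase, Proc.binders, List.mem_append, not_or]
      exact ⟨Or.inl h0.1, ⟨h0.2.1, hw.2.2.1 a h0.1⟩, h0.2.2.1, fun he => Or.inl (h0.2.2.2 he)⟩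
  | parR X Y Y' μ h hk ih =>
    simp only [RProc.erase, Proc.binders, List.nodup_append] at hnd
    have := ih hw.2.1 hnd.2.1
    refine ⟨⟨hw.1, this.wf, fun a ha hb => hw.2.2.1 a ha (this.binders _ hb),
      fun a ha => hw.2.2.2 a (this.resNames ha)⟩, Set.union_subset_union_right _ this.resNames,
      ?_, ?_, ?_⟩
    · simp only [RProc.erase, Proc.binders, List.mem_append]
      exact fun c => Or.imp_right (this.binders c)
    · intro b x h
      simp [RProc.erase, Proc.binders, this.inp b x h]
    · intro b a δ h
      have h0 := this.bout b a δ h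
      simp only [RProc.erase, Proc.binders, List.mem_append, not_or]
      exact ⟨Or.inr h0.1, ⟨hw.2.2.2 a h0.1, h0.2.1⟩, h0.2.2.1, fun he => Or.inr (h0.2.2.2 he)⟩
  | res a δ X X' μ h ha ih =>
    have := ih hw.1 (RProc.nodup_of_res hnd)
    have hn := hw.not_mem_binders hnd
    refine ⟨⟨this.wf, hw.2.1, fun _ hb => hn (this.binders _ hb)⟩,
      Set.union_subset_union_right _ this.resNames, ?_, fun b x h =>
      RProc.binders_erase_res_subset _ _ _ (this.inp b x h), ?_⟩
    · intro c hc
      have hb := this.binders c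
      by_cases hδ : δ.Empty
      · simp only [RProc.erase, hδ, if_true, Proc.binders, List.mem_cons] at hc ⊢
        exact hc.imp_right hb
      · simp only [RProc.erase, hδ, if_false] at hc ⊢
        exact hb hc
    · intro b c ε h
      have h0 := this.bout b c ε h
      have hca : c ≠ a := by
        rintro rfl
        simp [h, FAct.atoms] at ha
      refine ⟨Or.inr h0.1, ?_, h0.2.2.1, fun he =>
        RProc.binders_erase_res_subset _ _ _ (h0.2.2.2 he)⟩
      by_cases hδ : δ.Empty <;> simp [RProc.erase, hδ, Proc.binders, h0.2.1, hca]
  | comL X X' Y Y' i K K' j j' b a x h1 h2 hK hK' ih1 ih2 =>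
    simp only [RProc.erase, Proc.binders, List.nodup_append] at hnd
    have hX := ih1 hw.1 hnd.1
    have hY := ih2 hw.2.1 hnd.2.1
    refine ⟨(hX.com hY hw).1, ?_, ?_, by simp, by simp⟩
    · simpa [RProc.resNames, RProc.resNames_subst] using
        ⟨Set.subset_union_of_subset_left hX.resNames _,
          Set.subset_union_of_subset_right hY.resNames _⟩
    · simp only [RProc.erase, Proc.binders, List.mem_append, RProc.binders_erase_subst]
      exact fun c => Or.imp (hX.binders c) (hY.binders c)
  | comR X X' Y Y' i K K' j j' b a x h1 h2 hK hK' ih1 ih2 =>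
    simp only [RProc.erase, Proc.binders, List.nodup_append] at hnd
    have hX := ih1 hw.2.1 hnd.2.1
    have hY := ih2 hw.1 hnd.1
    refine ⟨(hX.com hY ⟨hw.2.1, hw.1, hw.2.2.2, hw.2.2.1⟩).2, ?_, ?_, by simp, by simp⟩
    · simpa [RProc.resNames, RProc.resNames_subst] using
        ⟨Set.subset_union_of_subset_left hY.resNames _,
          Set.subset_union_of_subset_right hX.resNames _⟩
    · simp only [RProc.erase, Proc.binders, List.mem_append, RProc.binders_erase_subst]
      exact fun c => Or.imp (hY.binders c) (hX.binders c)
  | causeRef a δ X X' i K K' j π h hs hδ hK ih =>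
    exact (ih hw.1 (RProc.nodup_of_res hnd)).res_update hw hnd hw.2.1 hδ (fun _ _ h => h)
      fun b c ε h => Or.inr ⟨b, h⟩
  | closeL X X' Y Y' i K K' j j' b a δ x h1 h2 hK hK' ih1 ih2 =>
    simp only [RProc.erase, Proc.binders, List.nodup_append] at hnd
    have hX := ih1 hw.1 hnd.1
    have hY := ih2 hw.2.1 hnd.2.1
    have h0 := hX.bout _ _ _ rfl
    refine ⟨(hX.close hY hw rfl).1, ?_, ?_, by simp, by simp⟩
    · rintro c (rfl | hc | hc)
      · exact Or.inl h0.1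
      · exact Or.inl (hX.resNames (by rwa [RProc.resNames_sharp] at hc))
      · exact Or.inr (hY.resNames (by rwa [RProc.resNames_subst] at hc))
    · have : ∀ c, c ∈ (RProc.par (X'.sharp i) (Y'.subst x (.name a) i)).erase.binders →
          c ∈ (RProc.par X Y).erase.binders := by
        simp only [RProc.erase, Proc.binders, List.mem_append, RProc.binders_erase_subst,
          hX.wf.erase_sharp]
        exact fun c => Or.imp (hX.binders c) (hY.binders c)
      intro c hc
      by_cases hδ : δ.Empty
      · rw [RProc.erase, if_pos hδ, Proc.binders, List.mem_cons] at hc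
        rcases hc with rfl | hc
        · exact List.mem_append_left _ (h0.2.2.2 hδ)
        · exact this c hc
      · rw [RProc.erase, if_neg hδ] at hc
        exact this c hc
  | closeR X X' Y Y' i K K' j j' b a δ x h1 h2 hK hK' ih1 ih2 =>
    simp only [RProc.erase, Proc.binders, List.nodup_append] at hnd
    have hX := ih1 hw.2.1 hnd.2.1
    have hY := ih2 hw.1 hnd.1
    have h0 := hX.bout _ _ _ rfl
    refine ⟨(hX.close hY ⟨hw.2.1, hw.1, hw.2.2.2, hw.2.2.1⟩ rfl).2, ?_, ?_, by simp, by simp⟩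
    · rintro c (rfl | hc | hc)
      · exact Or.inr h0.1
      · exact Or.inl (hY.resNames (by rwa [RProc.resNames_subst] at hc))
      · exact Or.inr (hX.resNames (by rwa [RProc.resNames_sharp] at hc))
    · have : ∀ c, c ∈ (RProc.par (Y'.subst x (.name a) i) (X'.sharp i)).erase.binders →
          c ∈ (RProc.par Y X).erase.binders := by
        simp only [RProc.erase, Proc.binders, List.mem_append, RProc.binders_erase_subst,
          hX.wf.erase_sharp]
        exact fun c => Or.imp (hY.binders c) (hX.binders c)
      intro c hc
      by_cases hδ : δ.Empty
      · rw [RProc.erase, if_pos hδ, Proc.binders, List.mem_cons] at hc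
        rcases hc with rfl | hc
        · exact List.mem_append_right _ (h0.2.2.2 hδ)
        · exact this c hc
      · rw [RProc.erase, if_neg hδ] at hc
        exact this c hc
  -- The rule Open: the memory is non-empty afterwards, so `a` ceases to be a binder.
  | _ a δ X X' i K K' j b π h hπ hb hK ih =>
    refine (ih hw.1 (RProc.nodup_of_res hnd)).res_update hw hnd (Mem.ok_add _ _)
      (Mem.not_empty_add _ _) (by simp) ?_
    rintro b c ε h
    simp only [FAct.bout.injEq] at h
    exact Or.inl ⟨h.2.1.symm, h.2.2.symm⟩

/-! ## The convention on bound names is preserved -/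

/-- The bound names and variables of a label as a multiset. -/
def BLabel.boundBinders : BLabel → Multiset Atom
  | .vis _ (.out _ _) => 0
  | .vis _ (.bout _ a) => {.name a}
  | .vis _ (.inp _ x) => {.var x}
  | .tau => 0

theorem BLabel.mem_boundBinders {ζ : BLabel} {c : Atom} : c ∈ ζ.boundBinders ↔ c ∈ ζ.bound := by
  rcases ζ with ⟨k, _ | _ | _⟩ | _ <;> simp [BLabel.boundBinders, BLabel.bound]

theorem Proc.free_subst_subset (P : Proc Atom) (x : Var) (v : Atom) :
    (P.subst x v).free ⊆ (P.free \ {.var x}) ∪ {v} := by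
  have h : ∀ c : Atom, Atom.replace x v c = c ∧ c ≠ .var x ∨ Atom.replace x v c = v := by
    intro c; unfold Atom.replace; split_ifs with h
    · exact Or.inr rfl
    · exact Or.inl ⟨rfl, h⟩
  unfold Proc.subst
  induction P with
  | nil => simp [Proc.substBy, Proc.free]
  | out b a P ih =>
    rintro c ((rfl | rfl) | hc)
    · rcases h b with h | h <;> simp [h, Proc.free]
    · rcases h a with h | h <;> simp [h, Proc.free]
    · rcases ih hc with h | h
      · exact Or.inl ⟨Or.inr h.1, h.2⟩
      · exact Or.inr h
  | inp b y P ih =>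
    rintro c (rfl | ⟨hc, hy⟩)
    · rcases h b with h | h <;> simp [h, Proc.free]
    · by_cases hyx : y = x
      · subst hyx
        rw [if_pos rfl] at hc
        exact Or.inl ⟨Or.inr ⟨hc, hy⟩, hy⟩
      · rw [if_neg hyx] at hc
        rcases ih hc with h | h
        · exact Or.inl ⟨Or.inr ⟨h.1, hy⟩, h.2⟩
        · exact Or.inr h
  | par P Q ihP ihQ =>
    rintro c (hc | hc)
    · rcases ihP hc with h | h
      · exact Or.inl ⟨Or.inl h.1, h.2⟩
      · exact Or.inr h
    · rcases ihQ hc with h | h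
      · exact Or.inl ⟨Or.inr h.1, h.2⟩
      · exact Or.inr h
  | res a P ih =>
    rintro c ⟨hc, ha⟩
    rcases ih hc with h | h
    · exact Or.inl ⟨⟨h.1, ha⟩, h.2⟩
    · exact Or.inr h

theorem BStep.label_free {A A' : CProc} {K : Set Key} {ζ : BLabel} (h : BStep A K ζ A') :
    ∀ c ∈ ζ.atoms, c ∈ ζ.bound ∨ c ∈ A.free := by
  induction h with
  | out b a P k =>
    rintro c (rfl | rfl) <;> simp [CProc.free, CProc.erase, Proc.free]
  | inp b x P k =>
    rintro c (rfl | rfl) <;> simp [CProc.free, CProc.erase, Proc.free, BLabel.bound]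
  | cau L A A' K ζ h hd ih => exact ih
  | parL A A' B K ζ h h1 h2 ih => exact fun c hc => (ih c hc).imp_right Or.inl
  | parR A A' B K ζ h h1 h2 ih => exact fun c hc => (ih c hc).imp_right Or.inr
  | res a A A' K ζ h ha ih =>
    exact fun c hc => (ih c hc).imp_right fun h => ⟨h, fun h' => ha (h' ▸ hc)⟩
  | comL => simp [BLabel.atoms]
  | comR => simp [BLabel.atoms]
  | closeL => simp [BLabel.atoms]
  | closeR => simp [BLabel.atoms]
  | _ a b A A' K k h hb ih =>
    rintro c (rfl | rfl)
    · refine Or.inr ⟨(ih c (Or.inl rfl)).resolve_left id, hb⟩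
    · exact Or.inl rfl

/-- A communication replaces the received variable by an object that was already free in the sender,
and Close binds the extruded name again. So only bound objects of a label can become free. -/
theorem BStep.free_subset {A A' : CProc} {K : Set Key} {ζ : BLabel} (h : BStep A K ζ A') :
    A'.free ⊆ A.free ∪ ζ.bound := by
  -- The residuals of sender and receiver: the substitution removes the input variable from the
  -- receiver at the price of the object `v`.
  have com : ∀ {A A' B B' : CProc} {ζ : BLabel} {k : Key} {b : Atom} {x : Var} {v : Atom}
      {K L : Set Key}, A'.free ⊆ A.free ∪ ζ.bound →
      B'.free ⊆ B.free ∪ (BLabel.vis k (.inp b x)).bound →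
      (∀ c ∈ (A'.replaceCause k L).free, c ∈ A.free ∨ c ∈ ζ.bound) ∧
      ∀ c ∈ ((B'.subst x v).replaceCause k K).free, c ∈ B.free ∨ c = v := by
    intro A A' B B' ζ k b x v K L hA hB
    constructor
    · intro c hc
      rw [CProc.free, CProc.erase_replaceCause] at hc
      exact hA hc
    · intro c hc
      rw [CProc.free, CProc.erase_replaceCause, CProc.erase_subst] at hc
      rcases Proc.free_subst_subset _ _ _ hc with ⟨hc, hx⟩ | hc
      · exact Or.inl ((hB hc).resolve_right hx)
      · exact Or.inr hc
  induction h with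
  | out b a P k =>
    intro c hc
    simp only [CProc.free, CProc.erase, CProc.erase_ofProc] at hc
    exact Or.inl (Or.inr hc)
  | inp b x P k =>
    intro c hc
    simp only [CProc.free, CProc.erase, CProc.erase_ofProc] at hc
    by_cases h : c = .var x
    · exact Or.inr h
    · exact Or.inl (Or.inr ⟨hc, h⟩)
  | cau L A A' K ζ h hd ih => exact ih
  | parL A A' B K ζ h h1 h2 ih =>
    rintro c (hc | hc)
    · exact (ih hc).imp_left Or.inl
    · exact Or.inl (Or.inr hc)
  | parR A B B' K ζ h h1 h2 ih =>
    rintro c (hc | hc)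
    · exact Or.inl (Or.inl hc)
    · exact (ih hc).imp_left Or.inr
  | res a A A' K ζ h ha ih =>
    exact fun c hc => (ih hc.1).imp_left fun h => ⟨h, hc.2⟩
  | comL A A' B B' K L k b a x h1 h2 ih1 ih2 =>
    have ha : a ∈ A.free := (h1.label_free a (Or.inr rfl)).resolve_left id
    rintro c (hc | hc)
    · exact Or.inl (Or.inl (((com ih1 ih2 (v := a) (K := K)).1 c hc).resolve_right id))
    · rcases (com (L := L) ih1 ih2).2 c hc with h | rfl
      · exact Or.inl (Or.inr h)
      · exact Or.inl (Or.inl ha)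
  | comR A A' B B' K L k b a x h1 h2 ih1 ih2 =>
    have ha : a ∈ A.free := (h1.label_free a (Or.inr rfl)).resolve_left id
    rintro c (hc | hc)
    · rcases (com (L := L) ih1 ih2).2 c hc with h | rfl
      · exact Or.inl (Or.inl h)
      · exact Or.inl (Or.inr ha)
    · exact Or.inl (Or.inr (((com ih1 ih2 (v := a) (K := K)).1 c hc).resolve_right id))
  | closeL A A' B B' K L k b a x h1 h2 hf ih1 ih2 =>
    rintro c ⟨hc | hc, hca⟩
    · exact Or.inl (Or.inl (((com ih1 ih2 (v := .name a) (K := K)).1 c hc).resolve_right hca))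
    · exact Or.inl (Or.inr (((com (L := L) ih1 ih2).2 c hc).resolve_right hca))
  | closeR A A' B B' K L k b a x h1 h2 hf ih1 ih2 =>
    rintro c ⟨hc | hc, hca⟩
    · exact Or.inl (Or.inl (((com (L := L) ih1 ih2).2 c hc).resolve_right hca))
    · exact Or.inl (Or.inr (((com ih1 ih2 (v := .name a) (K := K)).1 c hc).resolve_right hca))
  | _ a b A A' K k h hb ih =>
    intro c hc
    by_cases hca : c = .name a
    · exact Or.inr hca
    · exact Or.inl ⟨(ih hc).resolve_right id, hca⟩

/-- Without replication a binder is never copied: it stays, is discarded, or moves into the label.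
Counting with multiplicity gives both distinctness of the remaining binders and their disjointness
from the bound objects of the label. In Close, the binder taken from the sender is the one that
reappears. -/
theorem BStep.binders_le {A A' : CProc} {K : Set Key} {ζ : BLabel} (h : BStep A K ζ A') :
    ζ.boundBinders + (A'.erase.binders : Multiset Atom) ≤ (A.erase.binders : Multiset Atom) := by
  have right : ∀ {s t u : Multiset Atom}, s + t ≤ u → t ≤ u := fun h =>
    (Multiset.le_add_left _ _).trans h
  induction h with
  | out b a P k => simp [BLabel.boundBinders, CProc.erase, CProc.erase_ofProc, Proc.binders]
  | inp b x P k => simp [BLabel.boundBinders, CProc.erase, CProc.erase_ofProc, Proc.binders]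
  | cau L A A' K ζ h hd ih => exact ih
  | parL A A' B K ζ h h1 h2 ih =>
    simp only [CProc.erase, Proc.binders, ← Multiset.coe_add, ← add_assoc]
    gcongr
  | parR A B B' K ζ h h1 h2 ih =>
    simp only [CProc.erase, Proc.binders, ← Multiset.coe_add]
    rw [add_left_comm]
    gcongr
  | res a A A' K ζ h ha ih =>
    simp only [CProc.erase, Proc.binders, ← Multiset.cons_coe, Multiset.add_cons]
    exact Multiset.cons_le_cons _ ih
  | comL A A' B B' K L k b a x h1 h2 ih1 ih2 =>
    simp only [BLabel.boundBinders, CProc.erase, Proc.binders, ← Multiset.coe_add,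
      CProc.erase_replaceCause, CProc.erase_subst, Proc.binders_subst, zero_add] at ih1 ⊢
    exact add_le_add ih1 (right ih2)
  | comR A A' B B' K L k b a x h1 h2 ih1 ih2 =>
    simp only [BLabel.boundBinders, CProc.erase, Proc.binders, ← Multiset.coe_add,
      CProc.erase_replaceCause, CProc.erase_subst, Proc.binders_subst, zero_add] at ih1 ⊢
    exact add_le_add (right ih2) ih1
  | closeL A A' B B' K L k b a x h1 h2 hf ih1 ih2 =>
    simp only [BLabel.boundBinders, CProc.erase, Proc.binders, ← Multiset.coe_add,
      CProc.erase_replaceCause, CProc.erase_subst, Proc.binders_subst, zero_add,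
      Multiset.singleton_add, ← Multiset.cons_coe, ← Multiset.cons_add] at ih1 ⊢
    exact add_le_add ih1 (right ih2)
  | closeR A A' B B' K L k b a x h1 h2 hf ih1 ih2 =>
    simp only [BLabel.boundBinders, CProc.erase, Proc.binders, ← Multiset.coe_add,
      CProc.erase_replaceCause, CProc.erase_subst, Proc.binders_subst, zero_add,
      Multiset.singleton_add, ← Multiset.cons_coe, ← Multiset.add_cons] at ih1 ⊢
    exact add_le_add (right ih2) ih1
  | _ a b A A' K k h hb ih =>
    simp only [BLabel.boundBinders, CProc.erase, Proc.binders, ← Multiset.cons_coe,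
      Multiset.singleton_add, zero_add] at ih ⊢
    exact Multiset.cons_le_cons _ ih

/-- A name or variable free afterwards either was free before, hence no binder, or was bound by the
label, hence is used up as a binder. -/
theorem BStep.boundDistinct {A A' : CProc} {K : Set Key} {ζ : BLabel} (h : BStep A K ζ A')
    (hA : A.erase.BoundDistinct) : A'.erase.BoundDistinct := by
  have hle := h.binders_le
  have hnd := Multiset.nodup_of_le hle (Multiset.coe_nodup.2 hA.1)
  rw [Multiset.nodup_add] at hnd
  refine ⟨Multiset.coe_nodup.1 hnd.2.1, fun c hc hf => ?_⟩
  rcases h.free_subset hf with h' | h'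
  · exact hA.2 c (Multiset.mem_coe.1 (Multiset.mem_of_le hle
      (Multiset.mem_add.2 (Or.inr (Multiset.mem_coe.2 hc))))) h'
  · exact Multiset.disjoint_left.1 hnd.2.2 (BLabel.mem_boundBinders.2 h') (Multiset.mem_coe.2 hc)

theorem Proc.BoundDistinct.of_par {P Q : Proc Atom} (h : (Proc.par P Q).BoundDistinct) :
    P.BoundDistinct ∧ Q.BoundDistinct ∧ (∀ c ∈ P.binders, c ∉ Q.free) ∧
      ∀ c ∈ Q.binders, c ∉ P.free := by
  obtain ⟨hn, hf⟩ := h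
  simp only [Proc.binders, List.nodup_append, List.mem_append, Proc.free, Set.mem_union,
    not_or] at hn hf
  exact ⟨⟨hn.1, fun c hc => (hf c (Or.inl hc)).1⟩, ⟨hn.2.1, fun c hc => (hf c (Or.inr hc)).2⟩,
    fun c hc => (hf c (Or.inl hc)).2, fun c hc => (hf c (Or.inr hc)).1⟩

theorem Proc.BoundDistinct.of_res {a : Name} {P : Proc Atom} (h : (Proc.res a P).BoundDistinct) :
    P.BoundDistinct := by
  obtain ⟨hn, hf⟩ := h
  simp only [Proc.binders, List.nodup_cons] at hn hf
  refine ⟨hn.2, fun c hc hc' => hf c (List.mem_cons_of_mem _ hc) ⟨hc', ?_⟩⟩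
  rintro rfl
  exact hn.1 hc

theorem RProc.boundDistinct_of_res {a : Name} {δ : Mem} {X : RProc}
    (h : (RProc.res a δ X).erase.BoundDistinct) : X.erase.BoundDistinct := by
  by_cases hδ : δ.Empty
  · rw [RProc.erase, if_pos hδ] at h
    exact h.of_res
  · rwa [RProc.erase, if_neg hδ] at h

/-! ### Freshness of keys -/

theorem BStep.not_mem_keys {A A' : CProc} {K : Set Key} {k : Key} {π : BAct}
    (h : BStep A K (.vis k π) A') : k ∉ A.keys := by
  generalize hζ : BLabel.vis k π = ζ at h
  induction h generalizing π with
  | cau L A A' K ζ h hd ih =>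
    subst hζ
    exact fun hk => hk.elim (fun h => Set.disjoint_left.1 hd rfl h) (ih rfl)
  | parL A A' B K ζ h hd _ ih =>
    subst hζ
    exact fun hk => hk.elim (ih rfl) (fun h => Set.disjoint_left.1 hd rfl h)
  | parR A A' B K ζ h hd _ ih =>
    subst hζ
    exact fun hk => hk.elim (fun h => Set.disjoint_left.1 hd rfl h) (ih rfl)
  | res a A A' K ζ h ha ih => exact ih hζ
  | out => exact id
  | inp => exact id
  | comL => cases hζ
  | comR => cases hζ
  | closeL => cases hζ
  | closeR => cases hζ
  | _ a b A A' K k h hb ih =>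
    cases hζ
    exact ih rfl

theorem FStep.not_mem_keys {X X' : RProc} {μ : FLabel} (h : FStep X μ X') : μ.key ∉ X.keys := by
  induction h with
  | out1 => exact id
  | in1 => exact id
  | out2 => assumption
  | in2 => assumption
  | parL _ _ _ _ _ hk ih => exact fun h => h.elim ih hk
  | parR _ _ _ _ _ hk ih => exact fun h => h.elim hk ih
  | res _ _ _ _ _ _ _ ih => exact ih
  | causeRef _ _ _ _ _ _ _ _ _ _ _ _ _ ih => exact ih
  | comL _ _ _ _ _ _ _ _ _ _ _ _ _ _ _ _ ih1 ih2 => exact fun h => h.elim ih1 ih2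
  | comR _ _ _ _ _ _ _ _ _ _ _ _ _ _ _ _ ih1 ih2 => exact fun h => h.elim ih2 ih1
  | closeL _ _ _ _ _ _ _ _ _ _ _ _ _ _ _ _ _ ih1 ih2 => exact fun h => h.elim ih1 ih2
  | closeR _ _ _ _ _ _ _ _ _ _ _ _ _ _ _ _ _ ih1 ih2 => exact fun h => h.elim ih2 ih1
  | _ _ _ _ _ _ _ _ _ _ _ _ _ _ _ ih => exact ih

/-! ## New vertices -/

/-- The vertex that a vertex becomes when its process is put below a node. -/
def Vertex.push (t : Bool) (v : Vertex) : Vertex := (t :: v.1, v.2)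

/-- The union of the cause sets of the vertices in `V` whose address is a prefix of `d`. -/
def causesAt (V : List Vertex) (κ : Causes) (d : List Bool) : Set Key :=
  {m | ∃ u ∈ V, u.1 <+: d ∧ m ∈ κ u.1}

theorem causesAt_cons_map (V : List Vertex) (κ : Causes) (t : Bool) (j : Key) (d : List Bool) :
    causesAt (([], j) :: V.map (Vertex.push t)) κ (t :: d) =
      κ [] ∪ causesAt V (fun l => κ (t :: l)) d := by
  ext m; simp [causesAt, Vertex.push]

theorem causesAt_append_false (V W : List Vertex) (κ : Causes) (d : List Bool) :
    causesAt (V.map (Vertex.push false) ++ W.map (Vertex.push true)) κ (false :: d) =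
      causesAt V (fun l => κ (false :: l)) d := by
  ext m; simp [causesAt, Vertex.push, or_and_right, exists_or]

theorem causesAt_append_true (V W : List Vertex) (κ : Causes) (d : List Bool) :
    causesAt (V.map (Vertex.push false) ++ W.map (Vertex.push true)) κ (true :: d) =
      causesAt W (fun l => κ (true :: l)) d := by
  ext m; simp [causesAt, Vertex.push, or_and_right, exists_or]

/-- `V'` extends `V` by vertices with key `i` at the addresses in `D`, none of which is above
a vertex of `V`, the old vertices keep their cause sets, `K` is the set of all causes of the new
vertices, and each of them has got the causes in `K` and `E` altogether. -/
structure Ext (V V' : List Vertex) (κ κ' : Causes) (i : Key) (D : Set (List Bool))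
    (K E : Set Key) : Prop where
  nonempty : D.Nonempty
  mem : ∀ v, v ∈ V' ↔ v ∈ V ∨ (v.1 ∈ D ∧ v.2 = i)
  leaf : ∀ d ∈ D, ∀ u ∈ V, ¬ d <+: u.1
  agree : ∀ u ∈ V, κ' u.1 = κ u.1
  causes : K = ⋃ d ∈ D, causesAt V κ d
  new : ∀ d ∈ D, causesAt V κ d ∪ κ' d = K ∪ E

namespace Ext

variable {V V' W W' : List Vertex} {κ κ₁ κ₂ : Causes} {i j k : Key} {D : Set (List Bool)}
  {K L E : Set Key}

theorem push (h : Ext V V' (fun l => κ (false :: l)) κ₁ i D K E) :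
    Ext (([], j) :: V.map (Vertex.push false)) (([], j) :: V'.map (Vertex.push false)) κ
      (Causes.glue (κ []) κ₁ fun l => κ (true :: l)) i (List.cons false '' D) (κ [] ∪ K) E where
  nonempty := h.nonempty.image _
  mem v := by
    obtain ⟨l, m⟩ := v
    rcases l with _ | ⟨_ | _, l⟩ <;> simp [Vertex.push, h.mem]
  leaf := by
    rintro _ ⟨d, hd, rfl⟩ u hu
    simp only [List.mem_cons, List.mem_map] at hu
    rcases hu with rfl | ⟨u, hu, rfl⟩
    · simp
    · simpa [Vertex.push] using h.leaf d hd u hu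
  agree u hu := by
    simp only [List.mem_cons, List.mem_map] at hu
    rcases hu with rfl | ⟨u, hu, rfl⟩
    · rfl
    · exact h.agree u hu
  causes := by
    -- If there were no new address, the union would lose the causes `κ []` of the root.
    obtain ⟨d, hd⟩ := h.nonempty
    have hc := h.causes
    ext m
    simp only [Set.mem_union, hc, Set.mem_iUnion, Set.mem_image, exists_prop]
    constructor
    · rintro (hm | ⟨d, hd, hm⟩)
      · exact ⟨_, ⟨d, hd, rfl⟩, by rw [causesAt_cons_map]; exact Or.inl hm⟩
      · exact ⟨_, ⟨d, hd, rfl⟩, by rw [causesAt_cons_map]; exact Or.inr hm⟩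
    · rintro ⟨_, ⟨d, hd, rfl⟩, hm⟩
      rw [causesAt_cons_map] at hm
      exact hm.imp id fun h => ⟨d, hd, h⟩
  new := by
    rintro _ ⟨d, hd, rfl⟩
    rw [causesAt_cons_map, Set.union_assoc, Set.union_assoc, ← h.new d hd]
    rfl

theorem left (h : Ext V V' (fun l => κ (false :: l)) κ₁ i D K E) (W : List Vertex) :
    Ext (V.map (Vertex.push false) ++ W.map (Vertex.push true))
      (V'.map (Vertex.push false) ++ W.map (Vertex.push true)) κ
      (Causes.glue (κ []) κ₁ fun l => κ (true :: l)) i (List.cons false '' D) K E where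
  nonempty := h.nonempty.image _
  mem v := by
    obtain ⟨l, m⟩ := v
    rcases l with _ | ⟨_ | _, l⟩ <;> simp [Vertex.push, h.mem]
  leaf := by
    rintro _ ⟨d, hd, rfl⟩ u hu
    simp only [List.mem_append, List.mem_map] at hu
    rcases hu with ⟨u, hu, rfl⟩ | ⟨u, hu, rfl⟩
    · simpa [Vertex.push] using h.leaf d hd u hu
    · simp [Vertex.push]
  agree u hu := by
    simp only [List.mem_append, List.mem_map] at hu
    rcases hu with ⟨u, hu, rfl⟩ | ⟨u, hu, rfl⟩
    · exact h.agree u hu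
    · rfl
  causes := by simp [h.causes, causesAt_append_false]
  new := by
    rintro _ ⟨d, hd, rfl⟩
    rw [causesAt_append_false]
    exact h.new d hd

theorem right (h : Ext V V' (fun l => κ (true :: l)) κ₁ i D K E) (W : List Vertex) :
    Ext (W.map (Vertex.push false) ++ V.map (Vertex.push true))
      (W.map (Vertex.push false) ++ V'.map (Vertex.push true)) κ
      (Causes.glue (κ []) (fun l => κ (false :: l)) κ₁) i (List.cons true '' D) K E where
  nonempty := h.nonempty.image _
  mem v := by
    obtain ⟨l, m⟩ := v
    rcases l with _ | ⟨_ | _, l⟩ <;> simp [Vertex.push, h.mem]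
  leaf := by
    rintro _ ⟨d, hd, rfl⟩ u hu
    simp only [List.mem_append, List.mem_map] at hu
    rcases hu with ⟨u, hu, rfl⟩ | ⟨u, hu, rfl⟩
    · simp [Vertex.push]
    · simpa [Vertex.push] using h.leaf d hd u hu
  agree u hu := by
    simp only [List.mem_append, List.mem_map] at hu
    rcases hu with ⟨u, hu, rfl⟩ | ⟨u, hu, rfl⟩
    · rfl
    · exact h.agree u hu
  causes := by simp [h.causes, causesAt_append_true]
  new := by
    rintro _ ⟨d, hd, rfl⟩
    rw [causesAt_append_true]
    exact h.new d hd

theorem single (κ : Causes) (i k : Key) :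
    Ext [] [([], i)] κ (fun _ => {k}) i {[]} ∅ {k} where
  nonempty := Set.singleton_nonempty _
  mem v := by simp [Prod.ext_iff]
  leaf := by simp
  agree := by simp
  causes := by simp [causesAt]
  new := by simp [causesAt]

theorem replaceKey_of_notMem {S : Set Key} (h : k ∉ S) : replaceKey k L S = S := by
  ext m
  simp only [replaceKey, Set.mem_ofPred_eq, h, false_and, or_false, and_iff_left_iff_imp]
  rintro hm rfl
  exact h hm

theorem replaceKey_singleton : replaceKey k L {k} = L := by
  ext m; simp [replaceKey]

/-- The key `k` occurs in no old cause set, so the replacement affects only the two new vertices.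
The left one has `K` above it and receives `L`, the right one has `L` above it and receives `K`;
both reach `K ∪ L`, and nothing of `k` remains. -/
theorem com {d e : List Bool} (h₁ : Ext V V' (fun l => κ (false :: l)) κ₁ i {d} K {k})
    (h₂ : Ext W W' (fun l => κ (true :: l)) κ₂ i {e} L {k}) (hd : κ₁ d = {k}) (he : κ₂ e = {k})
    (hV : ∀ u ∈ V, k ∉ κ (false :: u.1)) (hW : ∀ u ∈ W, k ∉ κ (true :: u.1)) :
    Ext (V.map (Vertex.push false) ++ W.map (Vertex.push true))
      (V'.map (Vertex.push false) ++ W'.map (Vertex.push true)) κ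
      (Causes.glue (κ []) (fun l => replaceKey k L (κ₁ l)) fun l => replaceKey k K (κ₂ l)) i
      {false :: d, true :: e} (K ∪ L) ∅ where
  nonempty := ⟨_, Or.inl rfl⟩
  mem v := by
    obtain ⟨l, m⟩ := v
    rcases l with _ | ⟨_ | _, l⟩ <;> simp [Vertex.push, h₁.mem, h₂.mem]
  leaf := by
    have h1 := h₁.leaf d rfl
    have h2 := h₂.leaf e rfl
    simp only [Prod.forall] at h1 h2
    rintro _ (rfl | rfl) u hu <;> simp only [List.mem_append, List.mem_map] at hu <;>
      rcases hu with ⟨u, hu, rfl⟩ | ⟨u, hu, rfl⟩ <;> simp [Vertex.push]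
    · exact h1 _ _ hu
    · exact h2 _ _ hu
  agree u hu := by
    simp only [List.mem_append, List.mem_map] at hu
    rcases hu with ⟨u, hu, rfl⟩ | ⟨u, hu, rfl⟩
    · change replaceKey k L (κ₁ u.1) = κ (false :: u.1)
      rw [h₁.agree u hu, replaceKey_of_notMem (hV u hu)]
    · change replaceKey k K (κ₂ u.1) = κ (true :: u.1)
      rw [h₂.agree u hu, replaceKey_of_notMem (hW u hu)]
  causes := by
    simp [causesAt_append_true, causesAt_append_false, h₁.causes, h₂.causes]
  new := by
    have hK : K = causesAt V (fun l => κ (false :: l)) d := by simp [h₁.causes]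
    have hL : L = causesAt W (fun l => κ (true :: l)) e := by simp [h₂.causes]
    rintro _ (rfl | rfl)
    · rw [causesAt_append_false, ← hK, Set.union_empty]
      change K ∪ replaceKey k L (κ₁ d) = _
      rw [hd, replaceKey_singleton]
    · rw [causesAt_append_true, ← hL, Set.union_empty]
      change L ∪ replaceKey k K (κ₂ e) = _
      rw [he, replaceKey_singleton, Set.union_comm]

end Ext

theorem RProc.occs_par (X Y : RProc) :
    (RProc.par X Y).occs = X.occs.map (Vertex.push false) ++ Y.occs.map (Vertex.push true) := rfl

/-! ## From reversible to causal transitions -/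

theorem gamma_key (μ : FLabel) : ∀ k ∈ (gamma μ).keys, k = μ.key := by
  obtain ⟨i, K, j, _ | _ | _ | _⟩ := μ <;> simp [gamma, BLabel.keys]

theorem atoms_gamma (μ : FLabel) : (gamma μ).atoms = μ.act.atoms := by
  obtain ⟨i, K, j, _ | _ | ⟨b, a, δ⟩ | _⟩ := μ <;> simp [gamma, BLabel.atoms, FAct.atoms]
  split_ifs <;> rfl

/-- A bound name or variable of a label of `X` is a binder of `X`. -/
theorem StepWF.bound {X X' : RProc} {μ : FLabel} (h : StepWF X μ X') :
    ∀ c ∈ (gamma μ).bound, c ∈ X.erase.binders := by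
  obtain ⟨i, K, j, _ | ⟨b, x⟩ | ⟨b, a, δ⟩ | _⟩ := μ
  · simp [gamma, BLabel.bound]
  · simpa [gamma, BLabel.bound] using h.inp b x rfl
  · by_cases hδ : δ.Empty
    · simpa [gamma, BLabel.bound, hδ] using (h.bout b a δ rfl).2.2.2 hδ
    · simp [gamma, BLabel.bound, hδ]
  · simp [gamma, BLabel.bound]

/-- A visible transition from `X` to `X'` with key `i` adds a vertex at `d`, whose cause set consists
of the key `k` of the corresponding causal transition. -/
structure VisMatch (X X' : RProc) (κ κ' : Causes) (i k : Key) (d : List Bool) (K : Set Key) :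
    Prop where
  ext : Ext X.occs X'.occs κ κ' i {d} K {k}
  own : κ' d = {k}

namespace VisMatch

variable {X X' Y Y' : RProc} {κ κ' κ₁ κ₂ : Causes} {i k : Key} {d e : List Bool} {K L : Set Key}

theorem push {j : Key} (h : VisMatch X X' (fun l => κ (false :: l)) κ₁ i k d K) :
    Ext (([], j) :: X.occs.map (Vertex.push false)) (([], j) :: X'.occs.map (Vertex.push false)) κ
      (Causes.glue (κ []) κ₁ fun l => κ (true :: l)) i {false :: d} (κ [] ∪ K) {k} := by
  simpa using h.ext.push (j := j)

theorem left (h : VisMatch X X' (fun l => κ (false :: l)) κ₁ i k d K) (Y : RProc) :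
    VisMatch (.par X Y) (.par X' Y) κ (Causes.glue (κ []) κ₁ fun l => κ (true :: l)) i k
      (false :: d) K :=
  ⟨by simpa [RProc.occs_par] using h.ext.left Y.occs, h.own⟩

theorem right (h : VisMatch X X' (fun l => κ (true :: l)) κ₁ i k d K) (Y : RProc) :
    VisMatch (.par Y X) (.par Y X') κ (Causes.glue (κ []) (fun l => κ (false :: l)) κ₁) i k
      (true :: d) K :=
  ⟨by simpa [RProc.occs_par] using h.ext.right Y.occs, h.own⟩

theorem congr (h : VisMatch X X' κ κ' i k d K) (hX : Y.occs = X.occs) (hX' : Y'.occs = X'.occs) :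
    VisMatch Y Y' κ κ' i k d K :=
  ⟨by rw [hX, hX']; exact h.ext, h.own⟩

end VisMatch

theorem toC_res_of_not_empty {a : Name} {δ : Mem} (h : ¬ δ.Empty) (X : RProc) (κ : Causes) :
    (RProc.res a δ X).toC κ = X.toC κ := by
  simp [RProc.toC, h]

theorem toC_res_of_empty {a : Name} {δ : Mem} (h : δ.Empty) (X : RProc) (κ : Causes) :
    (RProc.res a δ X).toC κ = .res a (X.toC κ) := by
  simp [RProc.toC, h]

/-- Below a restriction of `a`, outputs of `a` are free outputs in the causal semantics. -/
theorem gamma_output {a : Name} {X X' : RProc} {i : Key} {K : Set SKey} {j : SKey}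
    {b : Atom} {π : FAct} (hs : StepWF X ⟨i, K, j, π⟩ X') (ha : .name a ∉ X.erase.binders)
    (hπ : π = .out b (.name a) ∨ ∃ δ', π = .bout b a δ') :
    gamma ⟨i, K, j, π⟩ = .vis i (.out b (.name a)) := by
  rcases hπ with rfl | ⟨δ', rfl⟩
  · rfl
  -- An extrusion with empty memory would come from a binder of `a` inside `X`.
  · have : ¬ δ'.Empty := fun h => ha ((hs.bout _ _ _ rfl).2.2.2 h)
    simp [gamma, this]

theorem disjoint_of_forall {ζ : BLabel} {i : Key} (hζ : ∀ k ∈ ζ.keys, k = i) {S : Set Key}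
    (h : i ∉ S) : Disjoint ζ.keys S :=
  Set.disjoint_left.2 fun k hk hS => h (hζ k hk ▸ hS)

theorem RProc.not_mem_keys_toC {X : RProc} {κ : Causes} {i : Key}
    (h : ∀ u ∈ X.occs, i ∉ κ u.1) : i ∉ (X.toC κ).keys := by
  rw [RProc.keys_toC]
  rintro ⟨u, hu, hi⟩
  exact h u hu hi

theorem disjoint_bound_free {X X' Y : RProc} {μ : FLabel} {κ : Causes} (hs : StepWF X μ X')
    (h : ∀ c ∈ X.erase.binders, c ∉ Y.erase.free) : Disjoint (gamma μ).bound (Y.toC κ).free :=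
  Set.disjoint_left.2 fun c hc hf => h c (hs.bound c hc) (by
    rwa [CProc.free, RProc.erase_toC] at hf)

theorem forall_occs_par {X Y : RProc} {κ : Causes} {i : Key}
    (h : ∀ u ∈ (RProc.par X Y).occs, i ∉ κ u.1) :
    (∀ u ∈ X.occs, i ∉ κ (false :: u.1)) ∧ ∀ u ∈ Y.occs, i ∉ κ (true :: u.1) :=
  ⟨fun _ hu => h _ (List.mem_append_left _ (List.mem_map_of_mem hu)),
    fun _ hu => h _ (List.mem_append_right _ (List.mem_map_of_mem hu))⟩

theorem BStep.of_fstep_past {A A' : CProc} {K S : Set Key} {μ : FLabel}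
    (h : BStep A K (gamma μ) A') (hS : μ.key ∉ S) :
    BStep (.cause S A) (S ∪ K) (gamma μ) (.cause S A') :=
  .cau _ _ _ _ _ h (disjoint_of_forall (gamma_key μ) hS)

/-- Each rule for visible actions becomes the causal rule of the same shape, except at restrictions
with non-empty memory: these are invisible to `toC`, so Res, Cause Ref and Open leave the causal
transition of the body as it is. The freshness of the key for `κ` is the side condition of the
causal rules for cause operators and parallel compositions. -/
theorem FStep.exists_bstep_vis {X X' : RProc} {μ : FLabel} (h : FStep X μ X') (hμ : μ.act ≠ .tau)
    (κ : Causes) (hw : X.WF) (hb : X.erase.BoundDistinct) (hκ : ∀ u ∈ X.occs, μ.key ∉ κ u.1) :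
    ∃ κ' d K, VisMatch X X' κ κ' μ.key μ.key d K ∧
      BStep (X.toC κ) K (gamma μ) (X'.toC κ') := by
  induction h generalizing κ with
  | out1 b a P i K =>
    refine ⟨fun _ => {i}, [], ∅, ⟨?_, rfl⟩, ?_⟩
    · simpa [RProc.occs, RProc.occs_ofProc] using Ext.single κ i i
    · simp only [RProc.toC, RProc.toC_ofProc]
      exact .out _ _ _ _
  | in1 b x P i K =>
    refine ⟨fun _ => {i}, [], ∅, ⟨?_, rfl⟩, ?_⟩
    · simpa [RProc.occs, RProc.occs_ofProc] using Ext.single κ i i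
    · simp only [RProc.toC, RProc.toC_ofProc]
      exact .inp _ _ _ _
  | out2 b a k L X X' μ h hk ih =>
    obtain ⟨κ', d, K, hm, hs⟩ := ih hμ (fun l => κ (false :: l)) hw hb
      fun u hu => hκ _ (List.mem_cons_of_mem _ (List.mem_map_of_mem hu))
    exact ⟨_, _, _, ⟨hm.push, hm.own⟩, hs.of_fstep_past (hκ _ List.mem_cons_self)⟩
  | in2 b x k L X X' μ h hk ih =>
    obtain ⟨κ', d, K, hm, hs⟩ := ih hμ (fun l => κ (false :: l)) hw hb
      fun u hu => hκ _ (List.mem_cons_of_mem _ (List.mem_map_of_mem hu))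
    exact ⟨_, _, _, ⟨hm.push, hm.own⟩, hs.of_fstep_past (hκ _ List.mem_cons_self)⟩
  | parL X X' Y μ h hk ih =>
    have hp := hb.of_par
    obtain ⟨h1, h2⟩ := forall_occs_par hκ
    obtain ⟨κ', d, K, hm, hs⟩ := ih hμ (fun l => κ (false :: l)) hw.1 hp.1 h1
    exact ⟨_, _, _, hm.left Y, .parL _ _ _ _ _ hs
      (disjoint_of_forall (gamma_key μ) (RProc.not_mem_keys_toC h2))
      (disjoint_bound_free (h.stepWF hw.1 hp.1.1) hp.2.2.1)⟩
  | parR X Y Y' μ h hk ih =>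
    have hp := hb.of_par
    obtain ⟨h1, h2⟩ := forall_occs_par hκ
    obtain ⟨κ', d, K, hm, hs⟩ := ih hμ (fun l => κ (true :: l)) hw.2.1 hp.2.1 h2
    exact ⟨_, _, _, hm.right X, .parR _ _ _ _ _ hs
      (disjoint_of_forall (gamma_key μ) (RProc.not_mem_keys_toC h1))
      (disjoint_bound_free (h.stepWF hw.2.1 hp.2.1.1) hp.2.2.2)⟩
  | res a δ X X' μ h ha ih =>
    obtain ⟨κ', d, K, hm, hs⟩ := ih hμ κ hw.1 (RProc.boundDistinct_of_res hb) hκ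
    refine ⟨κ', d, K, hm.congr rfl rfl, ?_⟩
    by_cases hδ : δ.Empty
    · rw [toC_res_of_empty hδ, toC_res_of_empty hδ]
      exact .res _ _ _ _ _ hs (by rwa [atoms_gamma])
    · rwa [toC_res_of_not_empty hδ, toC_res_of_not_empty hδ]
  | causeRef a δ X X' i K K' j π h hs hδ hK ih =>
    obtain ⟨κ', d, K, hm, hs⟩ := ih hμ κ hw.1 (RProc.boundDistinct_of_res hb) hκ
    refine ⟨κ', d, K, hm.congr rfl (RProc.occs_updateCause _ _ _ _), ?_⟩
    rw [toC_res_of_not_empty hδ, toC_res_of_not_empty hδ, RProc.toC_updateCause]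
    exact hs
  | comL => exact absurd rfl hμ
  | comR => exact absurd rfl hμ
  | closeL => exact absurd rfl hμ
  | closeR => exact absurd rfl hμ
  | _ a δ X X' i K K' j b π h hπ hne hK ih =>
    have hb' := RProc.boundDistinct_of_res hb
    obtain ⟨κ', d, K, hm, hs⟩ := ih
      (by rcases hπ with rfl | ⟨_, rfl⟩ <;> simp) κ hw.1 hb' hκ
    refine ⟨κ', d, K, hm.congr rfl (RProc.occs_updateCause _ _ _ _), ?_⟩
    -- The body may itself extrude `a` through an inner restriction of the same name; `γ` still sees
    -- a free output, as the causal rule `open` requires.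
    rw [gamma_output (h.stepWF hw.1 hb'.1) (hw.not_mem_binders hb.1) hπ] at hs
    rw [toC_res_of_not_empty (Mem.not_empty_add _ _), RProc.toC_updateCause]
    by_cases hδ : δ.Empty
    · rw [toC_res_of_empty hδ]
      simpa [gamma, hδ] using BStep.open _ _ _ _ _ _ hs (hne hδ)
    · rw [toC_res_of_not_empty hδ]
      simpa [gamma, hδ] using hs

/-- A silent transition from `X` to `X'` with key `i` adds two vertices, which have the same causes
`K`. -/
def TauMatch (X X' : RProc) (κ κ' : Causes) (i : Key) (K : Set Key) : Prop :=
  ∃ d e, d ≠ e ∧ Ext X.occs X'.occs κ κ' i {d, e} K ∅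

namespace TauMatch

variable {X X' Y Y' : RProc} {κ κ' κ₁ κ₂ : Causes} {i k : Key} {d e : List Bool} {K L : Set Key}

theorem push {j : Key} (h : TauMatch X X' (fun l => κ (false :: l)) κ₁ i K)
    (hY : Y.occs = ([], j) :: X.occs.map (Vertex.push false))
    (hY' : Y'.occs = ([], j) :: X'.occs.map (Vertex.push false)) :
    TauMatch Y Y' κ (Causes.glue (κ []) κ₁ fun l => κ (true :: l)) i (κ [] ∪ K) := by
  obtain ⟨d, e, hde, h⟩ := h
  refine ⟨false :: d, false :: e, by simpa, ?_⟩
  rw [hY, hY']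
  simpa [Set.image_pair] using h.push (j := j)

theorem left (h : TauMatch X X' (fun l => κ (false :: l)) κ₁ i K) (Y : RProc) :
    TauMatch (.par X Y) (.par X' Y) κ (Causes.glue (κ []) κ₁ fun l => κ (true :: l)) i K := by
  obtain ⟨d, e, hde, h⟩ := h
  exact ⟨false :: d, false :: e, by simpa,
    by simpa [Set.image_pair, RProc.occs_par] using h.left Y.occs⟩

theorem right (h : TauMatch X X' (fun l => κ (true :: l)) κ₁ i K) (Y : RProc) :
    TauMatch (.par Y X) (.par Y X') κ (Causes.glue (κ []) (fun l => κ (false :: l)) κ₁) i K := by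
  obtain ⟨d, e, hde, h⟩ := h
  exact ⟨true :: d, true :: e, by simpa,
    by simpa [Set.image_pair, RProc.occs_par] using h.right Y.occs⟩

theorem com {Z : RProc} (h₁ : VisMatch X X' (fun l => κ (false :: l)) κ₁ i k d K)
    (h₂ : VisMatch Y Y' (fun l => κ (true :: l)) κ₂ i k e L)
    (hκ : ∀ u ∈ (RProc.par X Y).occs, k ∉ κ u.1) (hZ : Z.occs = (RProc.par X' Y').occs) :
    TauMatch (.par X Y) Z κ
      (Causes.glue (κ []) (fun l => replaceKey k L (κ₁ l)) fun l => replaceKey k K (κ₂ l)) i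
      (K ∪ L) := by
  refine ⟨false :: d, true :: e, by simp, ?_⟩
  rw [hZ]
  exact h₁.ext.com h₂.ext h₁.own h₂.own (forall_occs_par hκ).1 (forall_occs_par hκ).2

end TauMatch

theorem RProc.toC_par_glue_subst_right (X Y : RProc) (S : Set Key) (κ₁ κ₂ : Causes) (k i : Key)
    (K L : Set Key) (x : Var) (v : Atom) :
    (RProc.par X (Y.subst x v i)).toC
      (Causes.glue S (fun l => replaceKey k L (κ₁ l)) fun l => replaceKey k K (κ₂ l)) =
    .par ((X.toC κ₁).replaceCause k L) (((Y.toC κ₂).subst x v).replaceCause k K) := by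
  rw [← RProc.toC_subst (i := i), RProc.toC_replaceCause, RProc.toC_replaceCause]
  rfl

theorem RProc.toC_par_glue_subst_left (X Y : RProc) (S : Set Key) (κ₁ κ₂ : Causes) (k i : Key)
    (K L : Set Key) (x : Var) (v : Atom) :
    (RProc.par (Y.subst x v i) X).toC
      (Causes.glue S (fun l => replaceKey k K (κ₂ l)) fun l => replaceKey k L (κ₁ l)) =
    .par (((Y.toC κ₂).subst x v).replaceCause k K) ((X.toC κ₁).replaceCause k L) := by
  rw [← RProc.toC_subst (i := i), RProc.toC_replaceCause, RProc.toC_replaceCause]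
  rfl

theorem RProc.WF.toC_par_sharp_right {X : RProc} (h : X.WF) (Y : RProc) (i : Key) (κ : Causes) :
    (RProc.par Y (X.sharp i)).toC κ = (RProc.par Y X).toC κ := by
  simp [RProc.toC, h.toC_sharp]

theorem RProc.WF.toC_par_sharp_left {X : RProc} (h : X.WF) (Y : RProc) (i : Key) (κ : Causes) :
    (RProc.par (X.sharp i) Y).toC κ = (RProc.par X Y).toC κ := by
  simp [RProc.toC, h.toC_sharp]

theorem StepWF.not_mem_free {X X' Y : RProc} {μ : FLabel} {b : Atom} {a : Name} {δ : Mem}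
    {κ : Causes} (hs : StepWF X μ X') (hμ : μ.act = .bout b a δ) (hδ : δ.Empty)
    (h : ∀ c ∈ X.erase.binders, c ∉ Y.erase.free) : .name a ∉ (Y.toC κ).free := by
  rw [CProc.free, RProc.erase_toC]
  exact h _ ((hs.bout b a δ hμ).2.2.2 hδ)

/-- The two synchronising actions have the same key on the reversible side, and this key also serves
as the causal key of both; it disappears in the exchange of causes. -/
theorem FStep.exists_bstep_tau {X X' : RProc} {μ : FLabel} (h : FStep X μ X') (hμ : μ.act = .tau)
    (κ : Causes) (hw : X.WF) (hb : X.erase.BoundDistinct) (hκ : ∀ u ∈ X.occs, μ.key ∉ κ u.1) :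
    ∃ κ' K, TauMatch X X' κ κ' μ.key K ∧ BStep (X.toC κ) K .tau (X'.toC κ') := by
  have hne : ∀ k ∈ BLabel.tau.keys, k = μ.key := fun _ h => h.elim
  have hfree : ∀ A : CProc, Disjoint BLabel.tau.bound A.free := fun _ => Set.empty_disjoint _
  induction h generalizing κ with
  | out2 b a k L X X' μ h hk ih =>
    obtain ⟨κ', K, hm, hs⟩ := ih hμ (fun l => κ (false :: l)) hw hb
      (fun u hu => hκ _ (List.mem_cons_of_mem _ (List.mem_map_of_mem hu))) hne
    exact ⟨_, _, hm.push rfl rfl, .cau _ _ _ _ _ hs (Set.empty_disjoint _)⟩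
  | in2 b x k L X X' μ h hk ih =>
    obtain ⟨κ', K, hm, hs⟩ := ih hμ (fun l => κ (false :: l)) hw hb
      (fun u hu => hκ _ (List.mem_cons_of_mem _ (List.mem_map_of_mem hu))) hne
    exact ⟨_, _, hm.push rfl rfl, .cau _ _ _ _ _ hs (Set.empty_disjoint _)⟩
  | parL X X' Y μ h hk ih =>
    obtain ⟨κ', K, hm, hs⟩ := ih hμ (fun l => κ (false :: l)) hw.1 hb.of_par.1
      (forall_occs_par hκ).1 hne
    exact ⟨_, _, hm.left Y, .parL _ _ _ _ _ hs (Set.empty_disjoint _) (hfree _)⟩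
  | parR X Y Y' μ h hk ih =>
    obtain ⟨κ', K, hm, hs⟩ := ih hμ (fun l => κ (true :: l)) hw.2.1 hb.of_par.2.1
      (forall_occs_par hκ).2 hne
    exact ⟨_, _, hm.right X, .parR _ _ _ _ _ hs (Set.empty_disjoint _) (hfree _)⟩
  | res a δ X X' μ h ha ih =>
    obtain ⟨κ', K, hm, hs⟩ := ih hμ κ hw.1 (RProc.boundDistinct_of_res hb) hκ hne
    refine ⟨κ', K, hm, ?_⟩
    by_cases hδ : δ.Empty
    · rw [toC_res_of_empty hδ, toC_res_of_empty hδ]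
      exact .res _ _ _ _ _ hs id
    · rwa [toC_res_of_not_empty hδ, toC_res_of_not_empty hδ]
  | causeRef a δ X X' i K K' j π h hs hδ hK ih =>
    cases hμ
    exact hs.elim
  | comL X X' Y Y' i K K' j j' b a x h1 h2 hK hK' ih1 ih2 =>
    obtain ⟨κ₁, d, K, hm1, hs1⟩ :=
      h1.exists_bstep_vis (by simp) (fun l => κ (false :: l)) hw.1 hb.of_par.1
      (forall_occs_par hκ).1
    obtain ⟨κ₂, e, L, hm2, hs2⟩ :=
      h2.exists_bstep_vis (by simp) (fun l => κ (true :: l)) hw.2.1 hb.of_par.2.1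
      (forall_occs_par hκ).2
    refine ⟨_, _, TauMatch.com hm1 hm2 hκ (by simp [RProc.occs, RProc.occs_subst]), ?_⟩
    rw [RProc.toC_par_glue_subst_right]
    exact .comL _ _ _ _ _ _ _ _ _ _ hs1 hs2
  | comR X X' Y Y' i K K' j j' b a x h1 h2 hK hK' ih1 ih2 =>
    obtain ⟨κ₁, d, K, hm1, hs1⟩ :=
      h1.exists_bstep_vis (by simp) (fun l => κ (true :: l)) hw.2.1 hb.of_par.2.1
      (forall_occs_par hκ).2
    obtain ⟨κ₂, e, L, hm2, hs2⟩ :=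
      h2.exists_bstep_vis (by simp) (fun l => κ (false :: l)) hw.1 hb.of_par.1
      (forall_occs_par hκ).1
    refine ⟨_, _, TauMatch.com hm2 hm1 hκ (by simp [RProc.occs, RProc.occs_subst]), ?_⟩
    rw [RProc.toC_par_glue_subst_left, Set.union_comm]
    exact .comR _ _ _ _ _ _ _ _ _ _ hs1 hs2
  | closeL X X' Y Y' i K K' j j' b a δ x h1 h2 hK hK' ih1 ih2 =>
    have hp := hb.of_par
    have hwf := h1.stepWF hw.1 hp.1.1
    obtain ⟨κ₁, d, K, hm1, hs1⟩ := h1.exists_bstep_vis (by simp) (fun l => κ (false :: l)) hw.1 hp.1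
      (forall_occs_par hκ).1
    obtain ⟨κ₂, e, L, hm2, hs2⟩ :=
      h2.exists_bstep_vis (by simp) (fun l => κ (true :: l)) hw.2.1 hp.2.1
      (forall_occs_par hκ).2
    refine ⟨_, _, TauMatch.com hm1 hm2 hκ
      (by simp [RProc.occs, RProc.occs_subst, RProc.occs_sharp]), ?_⟩
    by_cases hδ : δ.Empty
    · rw [toC_res_of_empty hδ, hwf.wf.toC_par_sharp_left,
        RProc.toC_par_glue_subst_right]
      exact .closeL _ _ _ _ _ _ _ _ _ _ (by simpa [gamma, hδ] using hs1) hs2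
        (hwf.not_mem_free rfl hδ hp.2.2.1)
    -- With non-empty memory the output counts as free and the new restriction is invisible, so
    -- Close is a plain communication of causal processes.
    · rw [toC_res_of_not_empty hδ, hwf.wf.toC_par_sharp_left,
        RProc.toC_par_glue_subst_right]
      exact .comL _ _ _ _ _ _ _ _ _ _ (by simpa [gamma, hδ] using hs1) hs2
  | closeR X X' Y Y' i K K' j j' b a δ x h1 h2 hK hK' ih1 ih2 =>
    have hp := hb.of_par
    have hwf := h1.stepWF hw.2.1 hp.2.1.1
    obtain ⟨κ₁, d, K, hm1, hs1⟩ :=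
      h1.exists_bstep_vis (by simp) (fun l => κ (true :: l)) hw.2.1 hp.2.1
      (forall_occs_par hκ).2
    obtain ⟨κ₂, e, L, hm2, hs2⟩ := h2.exists_bstep_vis (by simp) (fun l => κ (false :: l)) hw.1 hp.1
      (forall_occs_par hκ).1
    refine ⟨_, _, TauMatch.com hm2 hm1 hκ
      (by simp [RProc.occs, RProc.occs_subst, RProc.occs_sharp]), ?_⟩
    by_cases hδ : δ.Empty
    · rw [toC_res_of_empty hδ, hwf.wf.toC_par_sharp_right,
        RProc.toC_par_glue_subst_left, Set.union_comm]
      exact .closeR _ _ _ _ _ _ _ _ _ _ (by simpa [gamma, hδ] using hs1) hs2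
        (hwf.not_mem_free rfl hδ hp.2.2.2)
    · rw [toC_res_of_not_empty hδ, hwf.wf.toC_par_sharp_right,
        RProc.toC_par_glue_subst_left, Set.union_comm]
      exact .comR _ _ _ _ _ _ _ _ _ _ (by simpa [gamma, hδ] using hs1) hs2
  | _ => cases hμ

/-! ## From causal to reversible transitions -/

/-- Since `γ` identifies two kinds of output here, a causal communication may require either Com or
Close on the reversible side. -/
theorem act_of_gamma_out {i k : Key} {L : Set SKey} {j : SKey} {π : FAct} {b a : Atom}
    (h : gamma ⟨i, L, j, π⟩ = .vis k (.out b a)) :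
    π = .out b a ∨ ∃ c δ, a = .name c ∧ ¬ δ.Empty ∧ π = .bout b c δ := by
  rcases π with ⟨b', a'⟩ | ⟨b', x'⟩ | ⟨b', c, δ⟩ | _
  · simp only [gamma, BLabel.vis.injEq, BAct.out.injEq] at h
    simp [h]
  · simp [gamma] at h
  · by_cases hδ : δ.Empty
    · simp [gamma, hδ] at h
    · simp only [gamma, hδ, if_false, BLabel.vis.injEq, BAct.out.injEq] at h
      exact Or.inr ⟨c, δ, h.2.2.symm, hδ, by rw [h.2.1]⟩
  · simp [gamma] at h

theorem act_of_gamma_inp {i k : Key} {L : Set SKey} {j : SKey} {π : FAct} {b : Atom} {x : Var}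
    (h : gamma ⟨i, L, j, π⟩ = .vis k (.inp b x)) : π = .inp b x := by
  rcases π with ⟨b', a'⟩ | ⟨b', x'⟩ | ⟨b', c, δ⟩ | _
  · simp [gamma] at h
  · simp only [gamma, BLabel.vis.injEq, BAct.inp.injEq] at h
    simp [h]
  · by_cases hδ : δ.Empty <;> simp [gamma, hδ] at h
  · simp [gamma] at h

theorem act_of_gamma_bout {i k : Key} {L : Set SKey} {j : SKey} {π : FAct} {b : Atom} {a : Name}
    (h : gamma ⟨i, L, j, π⟩ = .vis k (.bout b a)) : ∃ δ, δ.Empty ∧ π = .bout b a δ := by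
  rcases π with ⟨b', a'⟩ | ⟨b', x'⟩ | ⟨b', c, δ⟩ | _
  · simp [gamma] at h
  · simp [gamma] at h
  · by_cases hδ : δ.Empty
    · simp only [gamma, hδ, if_true, BLabel.vis.injEq, BAct.bout.injEq] at h
      exact ⟨δ, hδ, by rw [h.2.1, h.2.2]⟩
    · simp [gamma, hδ] at h
  · simp [gamma] at h

/-- A restriction with non-empty memory lets through every action, up to `γ`. -/
theorem FStep.exists_res_of_not_empty {X X' : RProc} {i : Key} {L : Set SKey} {j : SKey}
    {π : FAct} (h : FStep X ⟨i, L, j, π⟩ X') (hL : none ∈ L) {a : Name} {δ : Mem}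
    (hδ : ¬ δ.Empty) (hs : StepWF X ⟨i, L, j, π⟩ X') (ha : .name a ∉ X.erase.binders) :
    ∃ X'' L' π', FStep (.res a δ X) ⟨i, L', j, π'⟩ X'' ∧ none ∈ L' ∧
      gamma ⟨i, L', j, π'⟩ = gamma ⟨i, L, j, π⟩ ∧ X''.occs = X'.occs ∧
      ∀ κ, X''.toC κ = X'.toC κ := by
  -- The rule is determined by the position of `a`: as object of an output it calls for Open, as
  -- subject only for Cause Ref, and otherwise for Res. Both cause predicates only enlarge the
  -- contextual cause set, so `*` stays in it.
  by_cases hobj : ∃ b, π = .out b (.name a) ∨ ∃ δ', π = .bout b a δ'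
  · obtain ⟨b, hπ⟩ := hobj
    refine ⟨_, _, _, .open a δ X X' i L _ j b π h hπ (fun h => absurd h hδ) rfl,
      Or.inl hL, ?_, RProc.occs_updateCause _ _ _ _, fun κ => ?_⟩
    · rw [gamma_output hs ha hπ]
      simp [gamma, hδ]
    · rw [toC_res_of_not_empty (Mem.not_empty_add _ _), RProc.toC_updateCause]
  · by_cases hsub : .name a ∈ π.sub
    · refine ⟨_, _, _, .causeRef a δ X X' i L _ j π h hsub hδ rfl, Or.inl hL, rfl,
        RProc.occs_updateCause _ _ _ _, fun κ => ?_⟩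
      rw [toC_res_of_not_empty hδ, RProc.toC_updateCause]
    · refine ⟨_, _, _, .res a δ X X' _ h ?_, hL, rfl, rfl,
        fun κ => toC_res_of_not_empty hδ _ _⟩
      rcases π with ⟨b, c⟩ | ⟨b, x⟩ | ⟨b, c, δ'⟩ | _
      · rintro (h | h)
        · exact hsub h
        · exact hobj ⟨b, Or.inl (by rw [h])⟩
      · rintro (h | h)
        · exact hsub h
        · cases h
      · rintro (h | h)
        · exact hsub h
        · cases h
          exact hobj ⟨b, Or.inr ⟨δ', rfl⟩⟩
      · exact id

/-- The induction is on `X` and not on the causal derivation, because restrictions with non-empty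
memory leave no trace in the latter. The reversible key `i` is independent of the causal key `k`:
inside a synchronisation `k` is fresh only for the cause sets and may already be the key of an
earlier silent action of `X`. The condition `none ∈ L` makes every later synchronisation admissible.
-/
theorem RProc.exists_fstep_vis (X : RProc) (κ : Causes) {K : Set Key} {k i : Key} {π : BAct}
    {A' : CProc} (h : BStep (X.toC κ) K (.vis k π) A') (hw : X.WF) (hb : X.erase.BoundDistinct)
    (hi : i ∉ X.keys) :
    ∃ X' L j act κ' d, FStep X ⟨i, L, j, act⟩ X' ∧ none ∈ L ∧
      gamma ⟨i, L, j, act⟩ = .vis i π ∧ A' = X'.toC κ' ∧ VisMatch X X' κ κ' i k d K := by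
  induction X generalizing κ K π A' with
  | nil => cases h
  | out b a P =>
    rw [RProc.toC] at h
    cases h
    -- The contextual cause set is free in this rule; `{*}` is compatible with every instantiator.
    refine ⟨_, {none}, _, _, fun _ => {k}, [], .out1 b a P i _, rfl, rfl, ?_, ?_, rfl⟩
    · rw [RProc.toC, RProc.toC_ofProc]
    · simpa [RProc.occs, RProc.occs_ofProc] using Ext.single κ i k
  | inp b x P =>
    rw [RProc.toC] at h
    cases h
    refine ⟨_, {none}, _, _, fun _ => {k}, [], .in1 b x P i _, rfl, rfl, ?_, ?_, rfl⟩
    · rw [RProc.toC, RProc.toC_ofProc]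
    · simpa [RProc.occs, RProc.occs_ofProc] using Ext.single κ i k
  | pastOut b a m M X ih =>
    rw [RProc.toC] at h
    rcases h with _ | _ | ⟨_, _, A', K, _, h, -⟩
    obtain ⟨X', L, j, act, κ', d, hs, hL, hg, rfl, hm⟩ := ih _ h hw hb (fun h => hi (Or.inr h))
    exact ⟨_, _, _, _, _, _, .out2 b a m M X X' _ hs hi, hL, hg, rfl, hm.push, hm.own⟩
  | pastInp b x m M X ih =>
    rw [RProc.toC] at h
    rcases h with _ | _ | ⟨_, _, A', K, _, h, -⟩
    obtain ⟨X', L, j, act, κ', d, hs, hL, hg, rfl, hm⟩ := ih _ h hw hb (fun h => hi (Or.inr h))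
    exact ⟨_, _, _, _, _, _, .in2 b x m M X X' _ hs hi, hL, hg, rfl, hm.push, hm.own⟩
  | par X Y ihX ihY =>
    rw [RProc.toC] at h
    have hp := hb.of_par
    cases h with
    | parL _ A' _ _ _ h _ _ =>
      obtain ⟨X', L, j, act, κ', d, hs, hL, hg, rfl, hm⟩ :=
        ihX _ h hw.1 hp.1 (fun h => hi (Or.inl h))
      exact ⟨_, _, _, _, _, _, .parL X X' Y _ hs (fun h => hi (Or.inr h)), hL, hg, rfl, hm.left Y⟩
    | parR _ _ A' _ _ h _ _ =>
      obtain ⟨X', L, j, act, κ', d, hs, hL, hg, rfl, hm⟩ :=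
        ihY _ h hw.2.1 hp.2.1 (fun h => hi (Or.inr h))
      exact ⟨_, _, _, _, _, _, .parR X Y X' _ hs (fun h => hi (Or.inl h)), hL, hg, rfl,
        hm.right X⟩
  | res a δ X ih =>
    have hb' := RProc.boundDistinct_of_res hb
    by_cases hδ : δ.Empty
    · rw [toC_res_of_empty hδ] at h
      cases h
      case res ha h =>
        obtain ⟨X', L, j, act, κ', d, hs, hL, hg, rfl, hm⟩ := ih _ h hw.1 hb' hi
        refine ⟨_, _, _, _, κ', d, .res a δ X X' _ hs ?_, hL, hg,
          (toC_res_of_empty hδ _ _).symm, hm.congr rfl rfl⟩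
        rw [← atoms_gamma, hg]
        cases π <;> exact ha
      -- The rule `open`: the body lets out `a` either directly or through an inner restriction of
      -- `a` with non-empty memory, and the reversible Open accepts both.
      · rename_i b hne h
        obtain ⟨X', L, j, act, κ', d, hs, hL, hg, rfl, hm⟩ := ih _ h hw.1 hb' hi
        refine ⟨_, _, _, _, κ', d, .open a δ X X' i L _ j b act hs ?_ (fun _ => hne) rfl,
          Or.inl hL, by simp [gamma, hδ], ?_, hm.congr rfl (RProc.occs_updateCause _ _ _ _)⟩
        · rcases act_of_gamma_out hg with h | ⟨c, δ', hc, -, h⟩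
          · exact Or.inl h
          · cases hc
            exact Or.inr ⟨δ', h⟩
        · rw [toC_res_of_not_empty (Mem.not_empty_add _ _), RProc.toC_updateCause]
    · rw [toC_res_of_not_empty hδ] at h
      obtain ⟨X', L, j, act, κ', d, hs, hL, hg, rfl, hm⟩ := ih _ h hw.1 hb' hi
      obtain ⟨X'', L', act', hs', hL', hg', ho, hc⟩ :=
        hs.exists_res_of_not_empty hL hδ (hs.stepWF hw.1 hb'.1) (hw.not_mem_binders hb.1)
      exact ⟨X'', L', j, act', κ', d, hs', hL', hg'.trans hg, (hc κ').symm, hm.congr rfl ho⟩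

/-- A visible key is fresh for the component that performs the action; in a synchronisation both
components do so with the same key. -/
theorem BStep.forall_not_mem {X Y : RProc} {κ : Causes} {A B : CProc} {K L : Set Key} {k : Key}
    {π ρ : BAct} (h₁ : BStep (X.toC fun l => κ (false :: l)) K (.vis k π) A)
    (h₂ : BStep (Y.toC fun l => κ (true :: l)) L (.vis k ρ) B) :
    ∀ u ∈ (RProc.par X Y).occs, k ∉ κ u.1 := by
  intro u hu hk
  simp only [RProc.occs_par, List.mem_append, List.mem_map] at hu
  rcases hu with ⟨u, hu, rfl⟩ | ⟨u, hu, rfl⟩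
  · exact h₁.not_mem_keys ((RProc.keys_toC _ _ _).2 ⟨u, hu, hk⟩)
  · exact h₂.not_mem_keys ((RProc.keys_toC _ _ _).2 ⟨u, hu, hk⟩)

/-- Any key that is fresh for `X` may be given to the silent action, since the causal label shows
none. -/
theorem RProc.exists_fstep_tau (X : RProc) (κ : Causes) {K : Set Key} {i : Key}
    {A' : CProc} (h : BStep (X.toC κ) K .tau A') (hw : X.WF) (hb : X.erase.BoundDistinct)
    (hi : i ∉ X.keys) :
    ∃ X' κ', FStep X ⟨i, {none}, none, .tau⟩ X' ∧ A' = X'.toC κ' ∧ TauMatch X X' κ κ' i K := by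
  induction X generalizing κ K A' with
  | nil => cases h
  | out b a P => cases h
  | inp b x P => cases h
  | pastOut b a m M X ih =>
    rw [RProc.toC] at h
    rcases h with _ | _ | ⟨_, _, A', K, _, h, -⟩
    obtain ⟨X', κ', hs, rfl, hm⟩ := ih _ h hw hb (fun h => hi (Or.inr h))
    exact ⟨_, _, .out2 b a m M X X' _ hs hi, rfl, hm.push rfl rfl⟩
  | pastInp b x m M X ih =>
    rw [RProc.toC] at h
    rcases h with _ | _ | ⟨_, _, A', K, _, h, -⟩
    obtain ⟨X', κ', hs, rfl, hm⟩ := ih _ h hw hb (fun h => hi (Or.inr h))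
    exact ⟨_, _, .in2 b x m M X X' _ hs hi, rfl, hm.push rfl rfl⟩
  | par X Y ihX ihY =>
    rw [RProc.toC] at h
    have hp := hb.of_par
    have hiX : i ∉ X.keys := fun h => hi (Or.inl h)
    have hiY : i ∉ Y.keys := fun h => hi (Or.inr h)
    cases h with
    | parL _ A' _ _ _ h _ _ =>
      obtain ⟨X', κ', hs, rfl, hm⟩ := ihX _ h hw.1 hp.1 hiX
      exact ⟨_, _, .parL X X' Y _ hs hiY, rfl, hm.left Y⟩
    | parR _ _ A' _ _ h _ _ =>
      obtain ⟨X', κ', hs, rfl, hm⟩ := ihY _ h hw.2.1 hp.2.1 hiY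
      exact ⟨_, _, .parR X Y X' _ hs hiX, rfl, hm.right X⟩
    | comL _ _ _ _ K L k b a x h1 h2 =>
      have hk := h1.forall_not_mem h2
      obtain ⟨X', M, j, act, κ₁, d, hs1, hM, hg1, rfl, hm1⟩ := X.exists_fstep_vis _ h1 hw.1 hp.1 hiX
      obtain ⟨Y', M', j', act', κ₂, e, hs2, hM', hg2, rfl, hm2⟩ :=
        Y.exists_fstep_vis _ h2 hw.2.1 hp.2.1 hiY
      cases act_of_gamma_inp hg2
      rcases act_of_gamma_out hg1 with rfl | ⟨c, δ, rfl, hδ, rfl⟩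
      · refine ⟨_, _, .comL X X' Y Y' i M M' j j' b a x hs1 hs2 (Or.inl hM) (Or.inl hM'), ?_,
          TauMatch.com hm1 hm2 hk (by simp [RProc.occs, RProc.occs_subst])⟩
        rw [RProc.toC_par_glue_subst_right]
      -- The free output is an extrusion through a non-empty memory, so a causal communication is
      -- matched by Close; the restriction that it adds is invisible.
      · refine ⟨_, _, .closeL X X' Y Y' i M M' j j' b c δ x hs1 hs2 (Or.inl hM) (Or.inl hM'), ?_,
          TauMatch.com hm1 hm2 hk (by simp [RProc.occs, RProc.occs_subst, RProc.occs_sharp])⟩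
        rw [toC_res_of_not_empty hδ, (hs1.stepWF hw.1 hp.1.1).wf.toC_par_sharp_left,
          RProc.toC_par_glue_subst_right]
    | comR _ _ _ _ K L k b a x h1 h2 =>
      have hk := h2.forall_not_mem h1
      obtain ⟨Y', M, j, act, κ₁, d, hs1, hM, hg1, rfl, hm1⟩ :=
        Y.exists_fstep_vis _ h1 hw.2.1 hp.2.1 hiY
      obtain ⟨X', M', j', act', κ₂, e, hs2, hM', hg2, rfl, hm2⟩ :=
        X.exists_fstep_vis _ h2 hw.1 hp.1 hiX
      cases act_of_gamma_inp hg2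
      -- The causal rule lists the causes of the sender first, `TauMatch.com` those of the left
      -- component.
      rw [Set.union_comm]
      rcases act_of_gamma_out hg1 with rfl | ⟨c, δ, rfl, hδ, rfl⟩
      · refine ⟨_, _, .comR Y Y' X X' i M M' j j' b a x hs1 hs2 (Or.inl hM) (Or.inl hM'), ?_,
          TauMatch.com hm2 hm1 hk (by simp [RProc.occs, RProc.occs_subst])⟩
        rw [RProc.toC_par_glue_subst_left]
      · refine ⟨_, _, .closeR Y Y' X X' i M M' j j' b c δ x hs1 hs2 (Or.inl hM) (Or.inl hM'), ?_,
          TauMatch.com hm2 hm1 hk (by simp [RProc.occs, RProc.occs_subst, RProc.occs_sharp])⟩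
        rw [toC_res_of_not_empty hδ, (hs1.stepWF hw.2.1 hp.2.1.1).wf.toC_par_sharp_right,
          RProc.toC_par_glue_subst_left]
    | closeL _ _ _ _ K L k b a x h1 h2 hf =>
      have hk := h1.forall_not_mem h2
      obtain ⟨X', M, j, act, κ₁, d, hs1, hM, hg1, rfl, hm1⟩ := X.exists_fstep_vis _ h1 hw.1 hp.1 hiX
      obtain ⟨Y', M', j', act', κ₂, e, hs2, hM', hg2, rfl, hm2⟩ :=
        Y.exists_fstep_vis _ h2 hw.2.1 hp.2.1 hiY
      cases act_of_gamma_inp hg2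
      obtain ⟨δ, hδ, rfl⟩ := act_of_gamma_bout hg1
      refine ⟨_, _, .closeL X X' Y Y' i M M' j j' b a δ x hs1 hs2 (Or.inl hM) (Or.inl hM'), ?_,
        TauMatch.com hm1 hm2 hk (by simp [RProc.occs, RProc.occs_subst, RProc.occs_sharp])⟩
      rw [toC_res_of_empty hδ, (hs1.stepWF hw.1 hp.1.1).wf.toC_par_sharp_left,
        RProc.toC_par_glue_subst_right]
    | closeR _ _ _ _ K L k b a x h1 h2 hf =>
      have hk := h2.forall_not_mem h1
      obtain ⟨Y', M, j, act, κ₁, d, hs1, hM, hg1, rfl, hm1⟩ :=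
        Y.exists_fstep_vis _ h1 hw.2.1 hp.2.1 hiY
      obtain ⟨X', M', j', act', κ₂, e, hs2, hM', hg2, rfl, hm2⟩ :=
        X.exists_fstep_vis _ h2 hw.1 hp.1 hiX
      cases act_of_gamma_inp hg2
      obtain ⟨δ, hδ, rfl⟩ := act_of_gamma_bout hg1
      rw [Set.union_comm]
      refine ⟨_, _, .closeR Y Y' X X' i M M' j j' b a δ x hs1 hs2 (Or.inl hM) (Or.inl hM'), ?_,
        TauMatch.com hm2 hm1 hk (by simp [RProc.occs, RProc.occs_subst, RProc.occs_sharp])⟩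
      rw [toC_res_of_empty hδ, (hs1.stepWF hw.2.1 hp.2.1.1).wf.toC_par_sharp_right,
        RProc.toC_par_glue_subst_left]
  | res a δ X ih =>
    have hb' := RProc.boundDistinct_of_res hb
    by_cases hδ : δ.Empty
    · rw [toC_res_of_empty hδ] at h
      cases h with
      | res _ _ A' _ _ h ha =>
        obtain ⟨X', κ', hs, rfl, hm⟩ := ih _ h hw.1 hb' hi
        exact ⟨_, κ', .res a δ X X' _ hs id, (toC_res_of_empty hδ _ _).symm, hm⟩
    · rw [toC_res_of_not_empty hδ] at h
      obtain ⟨X', κ', hs, rfl, hm⟩ := ih _ h hw.1 hb' hi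
      exact ⟨_, κ', .res a δ X X' _ hs id, (toC_res_of_not_empty hδ _ _).symm, hm⟩

/-! ## Histories -/

/-- The edges of the graph of a history. -/
def histEdge (V : List Vertex) (v w : Vertex) : Prop :=
  v ∈ V ∧ w ∈ V ∧ v ≠ w ∧ (v.1 <+: w.1 ∨ v.2 = w.2)

/-- No other vertex has the same key. -/
def UniqueKey (V : List Vertex) (v : Vertex) : Prop := ∀ w ∈ V, w.2 = v.2 → w = v

/-- The keys of unique vertices from which a path leads to `v`. -/
def pastKeys (V : List Vertex) (v : Vertex) : Set Key :=
  {k | ∃ u ∈ V, u.2 = k ∧ UniqueKey V u ∧ Relation.ReflTransGen (histEdge V) u v}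

/-- Vertices are determined by their addresses, and the cause sets at and above a vertex collect
the unique keys in its past. -/
structure IsHistory (V : List Vertex) (κ : Causes) : Prop where
  inj : ∀ v ∈ V, ∀ w ∈ V, v.1 = w.1 → v = w
  causes : ∀ v ∈ V, causesAt V κ v.1 = pastKeys V v

/-- Consequently a key that is fresh for the history is fresh for all cause sets. -/
theorem IsHistory.exists_key {V : List Vertex} {κ : Causes} (h : IsHistory V κ) {u : Vertex}
    (hu : u ∈ V) {m : Key} (hm : m ∈ κ u.1) : ∃ w ∈ V, w.2 = m := by
  have : m ∈ causesAt V κ u.1 := ⟨u, hu, List.prefix_rfl, hm⟩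
  rw [h.causes u hu] at this
  obtain ⟨w, hw, hk, -⟩ := this
  exact ⟨w, hw, hk⟩

namespace Ext

variable {V V' : List Vertex} {κ κ' : Causes} {i : Key} {D : Set (List Bool)} {K E : Set Key}

open Relation

theorem mem_of_mem (h : Ext V V' κ κ' i D K E) {v : Vertex} (hv : v ∈ V) : v ∈ V' :=
  (h.mem v).2 (Or.inl hv)

theorem edge_mono (h : Ext V V' κ κ' i D K E) {u v : Vertex} (hr : ReflTransGen (histEdge V) u v) :
    ReflTransGen (histEdge V') u v :=
  (ReflTransGen.mono (p := histEdge V')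
    fun _ _ he => ⟨h.mem_of_mem he.1, h.mem_of_mem he.2.1, he.2.2⟩) _ _ hr

/-- No edge leads from a new vertex to an old one: a new address is a prefix of no old address, and
the new key is fresh. -/
theorem reach_old (h : Ext V V' κ κ' i D K E) (hi : ∀ u ∈ V, u.2 ≠ i) {u v : Vertex}
    (hv : v ∈ V) (hr : ReflTransGen (histEdge V') u v) :
    u ∈ V ∧ ReflTransGen (histEdge V) u v := by
  induction hr using ReflTransGen.head_induction_on with
  | refl => exact ⟨hv, .refl⟩
  | head he _ ih =>
    obtain ⟨hc, hr⟩ := ih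
    obtain ⟨hu, -, hne, hor⟩ := he
    rcases (h.mem _).1 hu with hu | ⟨hd, hk⟩
    · exact ⟨hu, .head ⟨hu, hc, hne, hor⟩ hr⟩
    · rcases hor with hp | hp
      · exact absurd hp (h.leaf _ hd _ hc)
      · exact absurd (hp.symm.trans hk) (hi _ hc)

/-- Followed backwards, the path stays among the new vertices until it leaves them through a scope
edge, hence at an old vertex above some new address; from there on it is old. -/
theorem reach_new (h : Ext V V' κ κ' i D K E) (hi : ∀ u ∈ V, u.2 ≠ i) {u n : Vertex}
    (hn : n.1 ∈ D) (hni : n.2 = i) (hr : ReflTransGen (histEdge V') u n) :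
    (u.1 ∈ D ∧ u.2 = i) ∨
      ∃ d ∈ D, ∃ v ∈ V, v.1 <+: d ∧ u ∈ V ∧ ReflTransGen (histEdge V) u v := by
  induction hr using ReflTransGen.head_induction_on with
  | refl => exact Or.inl ⟨hn, hni⟩
  | head he _ ih =>
    rcases ih with ⟨hd, hk⟩ | ⟨d, hd, v, hv, hp, hc, hr⟩
    · obtain ⟨hu, -, hne, hor⟩ := he
      rcases (h.mem _).1 hu with hu | hu
      · rcases hor with hp | hp
        · exact Or.inr ⟨_, hd, _, hu, hp, hu, .refl⟩
        · exact absurd (hp.trans hk) (hi _ hu)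
      · exact Or.inl hu
    · have := h.reach_old hi hv (.head he (h.edge_mono hr))
      exact Or.inr ⟨d, hd, v, hv, hp, this⟩

theorem reach_of_prefix (h : Ext V V' κ κ' i D K E) (hi : ∀ u ∈ V, u.2 ≠ i) {u v n : Vertex}
    (hn : n.1 ∈ D) (hni : n.2 = i) {d : List Bool} (hd : d ∈ D) (hv : v ∈ V) (hp : v.1 <+: d)
    (hr : ReflTransGen (histEdge V) u v) : ReflTransGen (histEdge V') u n := by
  have hn' : n ∈ V' := (h.mem n).2 (Or.inr ⟨hn, hni⟩)
  have hd' : (d, i) ∈ V' := (h.mem _).2 (Or.inr ⟨hd, rfl⟩)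
  have h1 : ReflTransGen (histEdge V') u (d, i) :=
    (h.edge_mono hr).tail ⟨h.mem_of_mem hv, hd', fun e => hi v hv (by rw [e]), Or.inl hp⟩
  -- The path arrives at the new vertex at `d`; if this is not `n`, the edge between equal keys
  -- leads across.
  by_cases hdn : (d, i) = n
  · exact hdn ▸ h1
  · exact h1.tail ⟨hd', hn', hdn, Or.inr hni.symm⟩

theorem uniqueKey_iff (h : Ext V V' κ κ' i D K E) (hi : ∀ u ∈ V, u.2 ≠ i) {u : Vertex}
    (hu : u ∈ V) : UniqueKey V' u ↔ UniqueKey V u := by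
  refine ⟨fun hq w hw => hq w (h.mem_of_mem hw), fun hq w hw he => ?_⟩
  rcases (h.mem w).1 hw with hw | ⟨-, hk⟩
  · exact hq w hw he
  · exact absurd (he.symm.trans hk) (hi u hu)

theorem pastKeys_old (h : Ext V V' κ κ' i D K E) (hi : ∀ u ∈ V, u.2 ≠ i) {v : Vertex}
    (hv : v ∈ V) : pastKeys V' v = pastKeys V v := by
  ext k
  constructor
  · rintro ⟨u, -, hk, hq, hr⟩
    obtain ⟨hu, hr⟩ := h.reach_old hi hv hr
    exact ⟨u, hu, hk, (h.uniqueKey_iff hi hu).1 hq, hr⟩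
  · rintro ⟨u, hu, hk, hq, hr⟩
    exact ⟨u, h.mem_of_mem hu, hk, (h.uniqueKey_iff hi hu).2 hq, h.edge_mono hr⟩

theorem exists_pastKeys (h : Ext V V' κ κ' i D K E) (hh : IsHistory V κ) {m : Key} (hm : m ∈ K) :
    ∃ d ∈ D, ∃ w ∈ V, w.1 <+: d ∧ m ∈ pastKeys V w := by
  rw [h.causes] at hm
  simp only [Set.mem_iUnion, exists_prop] at hm
  obtain ⟨d, hd, w, hw, hp, hm⟩ := hm
  refine ⟨d, hd, w, hw, hp, ?_⟩
  rw [← hh.causes w hw]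
  exact ⟨w, hw, List.prefix_rfl, hm⟩

/-- Paths into one new vertex may pass through any other, so its past collects the pasts above all
of `D`. The fresh key itself counts only if it is not shared: `E` is `{i}` for a visible action and
empty for a silent one. -/
theorem pastKeys_new (h : Ext V V' κ κ' i D K E) (hh : IsHistory V κ) (hi : ∀ u ∈ V, u.2 ≠ i)
    (hE : ∀ m, m ∈ E ↔ m = i ∧ D.Subsingleton) {n : Vertex} (hn : n.1 ∈ D) (hni : n.2 = i) :
    pastKeys V' n = K ∪ E := by
  ext m
  constructor
  · rintro ⟨u, -, rfl, hq, hr⟩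
    rcases h.reach_new hi hn hni hr with ⟨hd, hk⟩ | ⟨d, hd, v, hv, hp, hu, hr⟩
    · refine Or.inr ((hE _).2 ⟨hk, fun d₁ h₁ d₂ h₂ => ?_⟩)
      have e₁ := hq (d₁, i) ((h.mem _).2 (Or.inr ⟨h₁, rfl⟩)) hk.symm
      have e₂ := hq (d₂, i) ((h.mem _).2 (Or.inr ⟨h₂, rfl⟩)) hk.symm
      exact congrArg Prod.fst (e₁.trans e₂.symm)
    · have hm : u.2 ∈ pastKeys V v := ⟨u, hu, rfl, (h.uniqueKey_iff hi hu).1 hq, hr⟩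
      rw [← hh.causes v hv] at hm
      obtain ⟨w, hw, hwp, hm⟩ := hm
      refine Or.inl ?_
      rw [h.causes]
      simp only [Set.mem_iUnion, exists_prop]
      exact ⟨d, hd, w, hw, hwp.trans hp, hm⟩
  · rintro (hm | hm)
    · obtain ⟨d, hd, w, hw, hp, u, hu, hk, hq, hr⟩ := h.exists_pastKeys hh hm
      exact ⟨u, h.mem_of_mem hu, hk, (h.uniqueKey_iff hi hu).2 hq,
        h.reach_of_prefix hi hn hni hd hw hp hr⟩
    · obtain ⟨rfl, hD⟩ := (hE m).1 hm
      refine ⟨n, (h.mem n).2 (Or.inr ⟨hn, hni⟩), hni, fun w hw he => ?_, .refl⟩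
      rcases (h.mem w).1 hw with hw | ⟨hd, hk⟩
      · exact absurd (he.trans hni) (hi w hw)
      · exact Prod.ext (hD hd hn) he

theorem isHistory (h : Ext V V' κ κ' i D K E) (hh : IsHistory V κ) (hi : ∀ u ∈ V, u.2 ≠ i)
    (hE : ∀ m, m ∈ E ↔ m = i ∧ D.Subsingleton) : IsHistory V' κ' where
  inj v hv w hw he := by
    rcases (h.mem v).1 hv with hv | ⟨hd, hk⟩ <;> rcases (h.mem w).1 hw with hw | ⟨hd', hk'⟩
    · exact hh.inj v hv w hw he
    · exact absurd (he ▸ List.prefix_rfl) (h.leaf _ hd' v hv)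
    · exact absurd (he ▸ List.prefix_rfl) (h.leaf _ hd w hw)
    · exact Prod.ext he (hk.trans hk'.symm)
  causes v hv := by
    rcases (h.mem v).1 hv with hv | ⟨hd, hk⟩
    · rw [h.pastKeys_old hi hv, ← hh.causes v hv]
      ext m
      constructor
      · rintro ⟨u, hu, hp, hm⟩
        rcases (h.mem u).1 hu with hu | ⟨hd, -⟩
        · exact ⟨u, hu, hp, h.agree u hu ▸ hm⟩
        · exact absurd hp (h.leaf _ hd v hv)
      · rintro ⟨u, hu, hp, hm⟩
        exact ⟨u, h.mem_of_mem hu, hp, (h.agree u hu).symm ▸ hm⟩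
    · rw [h.pastKeys_new hh hi hE hd hk]
      ext m
      constructor
      · rintro ⟨u, hu, hp, hm⟩
        rcases (h.mem u).1 hu with hu | ⟨hd', -⟩
        · rw [← h.new _ hd]
          exact Or.inl ⟨u, hu, hp, h.agree u hu ▸ hm⟩
        · rw [← h.new _ hd']
          exact Or.inr hm
      · rw [← h.new _ hd]
        rintro (⟨u, hu, hp, hm⟩ | hm)
        · exact ⟨u, h.mem_of_mem hu, hp, (h.agree u hu).symm ▸ hm⟩
        · exact ⟨v, (h.mem v).2 (Or.inr ⟨hd, hk⟩), List.prefix_rfl, hm⟩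

end Ext

/-! ### Contraction of bidirectional edges and the algorithm `Rem` -/

/-- A bidirectional edge forces equal keys, because two addresses that are prefixes of each other
coincide. Conversely, a vertex that shares its key with one that reaches `i` also reaches `i`, so
restricting to `G(i)` loses no such edge. -/
theorem RProc.contract_past_eq_key (X : RProc) (i : Key)
    (hinj : ∀ v ∈ X.occs, ∀ w ∈ X.occs, v.1 = w.1 → v = w) {v : Vertex} (hv : v ∈ X.occs)
    (hr : X.histGraph.Reaches i v) (k : Key) :
    (X.histGraph.past i).contract v = .key k ↔ UniqueKey X.occs v ∧ v.2 = k := by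
  have hiff : (∃ w, (X.histGraph.past i).Bidir v w) ↔ ¬ UniqueKey X.occs v := by
    constructor
    · rintro ⟨w, ⟨⟨-, hw, hne, h1⟩, -⟩, ⟨⟨-, -, -, h2⟩, -⟩⟩ hq
      rcases h1 with h1 | h1
      · rcases h2 with h2 | h2
        · exact hne (hinj v hv w hw (h1.eq_of_length_le h2.length_le))
        · exact hne (hq w hw h2).symm
      · exact hne (hq w hw h1.symm).symm
    · intro hq
      simp only [UniqueKey, not_forall, exists_prop] at hq
      obtain ⟨w, hw, hk, hne⟩ := hq
      have hrw : X.histGraph.Reaches i w := by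
        obtain ⟨n, hn, hni, hp⟩ := hr
        exact ⟨n, hn, hni, .head ⟨hw, hv, hne, Or.inr hk⟩ hp⟩
      exact ⟨w, ⟨⟨hv, hw, Ne.symm hne, Or.inr hk.symm⟩, hr, hrw⟩,
        ⟨⟨hw, hv, hne, Or.inr hk⟩, hrw, hr⟩⟩
  unfold HistGraph.contract
  by_cases hq : UniqueKey X.occs v
  · rw [if_neg (by rw [hiff]; exact not_not.2 hq)]
    simp [hq]
  · rw [if_pos (hiff.2 hq)]
    simp [hq]

theorem RProc.mem_rem_structCauses (X : RProc) (i : Key)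
    (hinj : ∀ v ∈ X.occs, ∀ w ∈ X.occs, v.1 = w.1 → v = w) (k : Key) :
    k ∈ X.Rem i (X.structCauses i) ↔ k ≠ i ∧ ∃ v ∈ X.occs, v.2 = k ∧ UniqueKey X.occs v ∧
      X.histGraph.Reaches i v := by
  have hv : ∀ v, v ∈ (X.histGraph.past i).verts ↔ v ∈ X.occs ∧ X.histGraph.Reaches i v := by
    intro v
    simp only [HistGraph.past, Multiset.mem_filter]
    rfl
  constructor
  · rintro ⟨hk, v, hm, hc⟩
    obtain ⟨hm, hr⟩ := (hv v).1 hm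
    rw [X.contract_past_eq_key i hinj hm hr] at hc
    exact ⟨(Multiset.mem_filter.1 hk).2, v, hm, hc.2, hc.1, hr⟩
  · rintro ⟨hk, v, hm, hvk, hq, hr⟩
    have hm' := (hv v).2 ⟨hm, hr⟩
    exact ⟨Multiset.mem_filter.2 ⟨Multiset.mem_map.2 ⟨v, hm', hvk⟩, hk⟩, v, hm',
      (X.contract_past_eq_key i hinj hm hr k).2 ⟨hq, hvk⟩⟩

/-- All vertices with key `i` are new, so the surviving keys lie in `K ∪ E`. Since `E` contains at
most `i`, which is excluded, `K` remains. -/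
theorem Ext.rem_structCauses {V : List Vertex} {X' : RProc} {κ κ' : Causes} {i : Key}
    {D : Set (List Bool)} {K E : Set Key} (h : Ext V X'.occs κ κ' i D K E) (hh : IsHistory V κ)
    (hi : ∀ u ∈ V, u.2 ≠ i) (hE : ∀ m, m ∈ E ↔ m = i ∧ D.Subsingleton) :
    X'.Rem i (X'.structCauses i) = K := by
  ext k
  rw [X'.mem_rem_structCauses i (h.isHistory hh hi hE).inj]
  constructor
  · rintro ⟨hk, v, hv, hvk, hq, n, hn, hni, hr⟩
    have hnD : n.1 ∈ D := (((h.mem n).1 hn).resolve_left fun hn => hi n hn hni).1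
    have hm : k ∈ pastKeys X'.occs n := ⟨v, hv, hvk, hq, hr⟩
    rw [h.pastKeys_new hh hi hE hnD hni] at hm
    exact hm.resolve_right fun hm => hk ((hE k).1 hm).1
  · intro hk
    obtain ⟨d, hd⟩ := h.nonempty
    have hm : k ∈ pastKeys X'.occs (d, i) := by
      rw [h.pastKeys_new hh hi hE hd rfl]
      exact Or.inl hk
    -- A cause in `K` is the key of an old vertex, hence different from `i`.
    obtain ⟨-, -, -, -, -, u, hu, hki, -⟩ := h.exists_pastKeys hh hk
    obtain ⟨v, hv, hvk, hq, hr⟩ := hm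
    exact ⟨hki ▸ hi u hu, v, hv, hvk, hq, (d, i), (h.mem _).2 (Or.inr ⟨hd, rfl⟩), rfl, hr⟩

/-! ## The correspondence of single transitions -/

/-- The invariant of corresponding traces. -/
structure Inv (X : RProc) (κ : Causes) : Prop where
  wf : X.WF
  boundDistinct : X.erase.BoundDistinct
  history : IsHistory X.occs κ

theorem inv_initial {P : Proc Atom} (hP : P.BoundDistinct) (κ : Causes) :
    Inv (RProc.initial P) κ := by
  have he : (RProc.initial P).erase = P := by
    rw [← RProc.erase_toC _ κ, RProc.toC_initial, CProc.erase_ofProc]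
  refine ⟨RProc.wf_ofProc ?_, he.symm ▸ hP, ?_⟩
  · rw [← RProc.erase_ofProc]
    exact he.symm ▸ hP.1
  · rw [RProc.initial, RProc.occs_ofProc]
    exact ⟨by simp, by simp⟩

/-- Each invariant is carried by the side where it is easy: well-formedness by the reversible
transition, the convention on bound names by the causal one, and the history by the extension. -/
theorem Inv.step {X X' : RProc} {κ κ' : Causes} {μ : FLabel} {D : Set (List Bool)}
    {K E : Set Key} {ζ : BLabel} (h : Inv X κ) (hs : FStep X μ X')
    (hb : BStep (X.toC κ) K ζ (X'.toC κ')) (he : Ext X.occs X'.occs κ κ' μ.key D K E)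
    (hE : ∀ m, m ∈ E ↔ m = μ.key ∧ D.Subsingleton) :
    Inv X' κ' ∧ X'.Rem μ.key (X'.structCauses μ.key) = K := by
  have hi : ∀ u ∈ X.occs, u.2 ≠ μ.key := fun u hu hk =>
    hs.not_mem_keys (RProc.mem_keys.2 ⟨u, hu, hk⟩)
  refine ⟨⟨(hs.stepWF h.wf h.boundDistinct.1).wf, ?_, he.isHistory h.history hi hE⟩,
    he.rem_structCauses h.history hi hE⟩
  have := hb.boundDistinct (by rw [RProc.erase_toC]; exact h.boundDistinct)
  rwa [RProc.erase_toC] at this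

theorem Inv.step_vis {X X' : RProc} {κ κ' : Causes} {μ : FLabel} {d : List Bool}
    {K : Set Key} {ζ : BLabel} (h : Inv X κ) (hs : FStep X μ X')
    (hb : BStep (X.toC κ) K ζ (X'.toC κ')) (hm : VisMatch X X' κ κ' μ.key μ.key d K) :
    Inv X' κ' ∧ X'.Rem μ.key (X'.structCauses μ.key) = K :=
  h.step hs hb hm.ext fun m => by simp

theorem Inv.step_tau {X X' : RProc} {κ κ' : Causes} {μ : FLabel}
    {K : Set Key} {ζ : BLabel} (h : Inv X κ) (hs : FStep X μ X')
    (hb : BStep (X.toC κ) K ζ (X'.toC κ')) (hm : TauMatch X X' κ κ' μ.key K) :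
    Inv X' κ' ∧ X'.Rem μ.key (X'.structCauses μ.key) = K := by
  obtain ⟨d, e, hde, he⟩ := hm
  exact h.step hs hb he fun m => by
    simp only [Set.mem_empty_iff_false, false_iff, not_and]
    exact fun _ hD => hde (hD (Or.inl rfl) (Or.inr rfl))

theorem Inv.exists_bstep {X X' : RProc} {κ : Causes} {μ : FLabel} (h : Inv X κ)
    (hs : FStep X μ X') :
    ∃ κ' K, BStep (X.toC κ) K (gamma μ) (X'.toC κ') ∧ Inv X' κ' ∧
      X'.Rem μ.key (X'.structCauses μ.key) = K := by
  have hκ : ∀ u ∈ X.occs, μ.key ∉ κ u.1 := fun u hu hm =>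
    hs.not_mem_keys (RProc.mem_keys.2 (h.history.exists_key hu hm))
  by_cases hμ : μ.act = .tau
  · obtain ⟨κ', K, hm, hb⟩ := hs.exists_bstep_tau hμ κ h.wf h.boundDistinct hκ
    have hg : gamma μ = .tau := by simp [gamma, hμ]
    exact ⟨κ', K, hg ▸ hb, h.step_tau hs hb hm⟩
  · obtain ⟨κ', d, K, hm, hb⟩ := hs.exists_bstep_vis hμ κ h.wf h.boundDistinct hκ
    exact ⟨κ', K, hb, h.step_vis hs hb hm⟩

theorem Ext.keys {X X' : RProc} {κ κ' : Causes} {i : Key} {D : Set (List Bool)} {K E : Set Key}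
    (h : Ext X.occs X'.occs κ κ' i D K E) {k : Key} (hk : k ∈ X'.keys) : k ∈ X.keys ∨ k = i := by
  obtain ⟨u, hu, rfl⟩ := RProc.mem_keys.1 hk
  exact ((h.mem u).1 hu).imp (fun hu => RProc.mem_keys.2 ⟨u, hu, rfl⟩) And.right

theorem Ext.keys_toC_subset {X X' : RProc} {κ κ' : Causes} {i : Key} {D : Set (List Bool)}
    {K E : Set Key} (h : Ext X.occs X'.occs κ κ' i D K E) :
    (X.toC κ).keys ⊆ (X'.toC κ').keys := by
  intro k hk
  obtain ⟨u, hu, hk⟩ := (RProc.keys_toC _ _ _).1 hk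
  exact (RProc.keys_toC _ _ _).2 ⟨u, h.mem_of_mem hu, (h.agree u hu).symm ▸ hk⟩

/-- Keys of silent actions are chosen above `N`, the other keys occur in the causal process. -/
def KeysBound (N : ℕ) (X : RProc) (κ : Causes) : Prop := ∀ k ∈ X.keys, k ∈ (X.toC κ).keys ∨ N ≤ k

/-- A visible causal key can be reused in the reversible process: it is below `N`, so a clash with a
key of `X` would be a clash with a cause set. The bound persists because old cause sets are kept,
and a new visible vertex carries its own key as a cause. -/
theorem Inv.exists_fstep {X : RProc} {κ : Causes} {K : Set Key} {ζ : BLabel} {A' : CProc} {N : ℕ}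
    (h : Inv X κ) (hN : KeysBound N X κ) (hb : BStep (X.toC κ) K ζ A')
    (hζ : ∀ k ∈ ζ.keys, k < N) :
    ∃ X' μ κ', FStep X μ X' ∧ ζ = gamma μ ∧ A' = X'.toC κ' ∧ Inv X' κ' ∧ KeysBound N X' κ' ∧
      X'.Rem μ.key (X'.structCauses μ.key) = K := by
  rcases ζ with ⟨k, π⟩ | _
  · have hk : k ∉ X.keys := fun hk => (hN k hk).elim hb.not_mem_keys
      (not_le_of_gt (hζ k rfl))
    obtain ⟨X', L, j, act, κ', d, hs, -, hg, rfl, hm⟩ :=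
      X.exists_fstep_vis κ hb h.wf h.boundDistinct hk
    obtain ⟨hinv, hrem⟩ := h.step_vis hs hb hm
    refine ⟨X', _, κ', hs, hg.symm, rfl, hinv, fun m hm' => ?_, hrem⟩
    rcases hm.ext.keys hm' with hm' | rfl
    · exact (hN m hm').imp_left fun h => hm.ext.keys_toC_subset h
    · exact Or.inl ((RProc.keys_toC _ _ _).2
        ⟨(d, m), (hm.ext.mem _).2 (Or.inr ⟨rfl, rfl⟩), by rw [hm.own]; rfl⟩)
  · obtain ⟨i, hi⟩ := Infinite.exists_notMem_finset
      ((X.occs.map Prod.snd).toFinset ∪ Finset.range N)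
    simp only [Finset.mem_union, List.mem_toFinset, List.mem_map, Finset.mem_range, not_or,
      not_lt] at hi
    obtain ⟨X', κ', hs, rfl, hm⟩ := X.exists_fstep_tau κ hb h.wf h.boundDistinct
      (fun hk => hi.1 (RProc.mem_keys.1 hk))
    obtain ⟨hinv, hrem⟩ := h.step_tau hs hb hm
    obtain ⟨d, e, -, he⟩ := hm
    refine ⟨X', _, κ', hs, rfl, rfl, hinv, fun m hm' => ?_, hrem⟩
    rcases he.keys hm' with hm' | rfl
    · exact (hN m hm').imp_left fun h => he.keys_toC_subset h
    · exact Or.inr hi.2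

/-! ## Traces -/

/-- A dependent choice along a finite sequence. -/
theorem exists_fin_seq {α : Type} {n : ℕ} (S : Fin (n + 1) → α → Prop)
    (R : ∀ _ : Fin n, α → α → Prop) (a : α) (h0 : S 0 a)
    (hstep : ∀ (i : Fin n) (x : α), S i.castSucc x → ∃ y, S i.succ y ∧ R i x y) :
    ∃ f : Fin (n + 1) → α, f 0 = a ∧ (∀ i, S i (f i)) ∧
      ∀ i : Fin n, R i (f i.castSucc) (f i.succ) := by
  choose g hg using hstep
  let f : ∀ i : Fin (n + 1), {x // S i x} :=
    Fin.induction ⟨a, h0⟩ fun i x => ⟨g i x.1 x.2, (hg i x.1 x.2).1⟩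
  refine ⟨fun i => (f i).1, rfl, fun i => (f i).2, fun i => ?_⟩
  have : f i.succ = ⟨g i (f i.castSucc).1 (f i.castSucc).2, (hg i _ _).1⟩ :=
    Fin.induction_succ _ _ _
  change R i (f i.castSucc).1 (f i.succ).1
  rw [this]
  exact (hg i _ _).2

theorem exists_key_bound {n : ℕ} (ζ : Fin n → BLabel) : ∃ N, ∀ i, ∀ k ∈ (ζ i).keys, k < N := by
  have h : ∀ i, ∃ N, ∀ k ∈ (ζ i).keys, k < N := by
    intro i
    rcases ζ i with ⟨k, π⟩ | _
    · exact ⟨k + 1, by rintro _ rfl; exact Nat.lt_succ_self _⟩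
    · exact ⟨0, fun _ h => h.elim⟩
  choose f hf using h
  exact ⟨Finset.univ.sup f, fun i k hk =>
    (hf i k hk).trans_le (Finset.le_sup (Finset.mem_univ i))⟩

end PiCausal

theorem mainTheorem3 (P : Proc Atom) (hP : P.BoundDistinct) (n : ℕ) :
    (∀ (A : Fin (n + 1) → CProc) (KB : Fin n → Set Key) (ζ : Fin n → BLabel),
      A 0 = CProc.ofProc P →
      (∀ i : Fin n, BStep (A i.castSucc) (KB i) (ζ i) (A i.succ)) →
      ∃ (X : Fin (n + 1) → RProc) (KF : Fin n → Multiset Key) (μ : Fin n → FLabel),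
        X 0 = RProc.initial P ∧
        (∀ i : Fin n, FStepK (X i.castSucc) (KF i) (μ i) (X i.succ)) ∧
        (∀ i : Fin (n + 1), (A i).erase = (X i).erase) ∧
        (∀ i : Fin n, ζ i = gamma (μ i)) ∧
        (∀ i : Fin n, (X i.succ).Rem (μ i).key (KF i) = KB i)) ∧
    (∀ (X : Fin (n + 1) → RProc) (KF : Fin n → Multiset Key) (μ : Fin n → FLabel),
      X 0 = RProc.initial P →
      (∀ i : Fin n, FStepK (X i.castSucc) (KF i) (μ i) (X i.succ)) →
      ∃ (A : Fin (n + 1) → CProc) (KB : Fin n → Set Key) (ζ : Fin n → BLabel),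
        A 0 = CProc.ofProc P ∧
        (∀ i : Fin n, BStep (A i.castSucc) (KB i) (ζ i) (A i.succ)) ∧
        (∀ i : Fin (n + 1), (A i).erase = (X i).erase) ∧
        (∀ i : Fin n, ζ i = gamma (μ i)) ∧
        (∀ i : Fin n, (X i.succ).Rem (μ i).key (KF i) = KB i)) := by
  constructor
  · intro A KB ζ hA hstep
    obtain ⟨N, hN⟩ := exists_key_bound ζ
    -- The reversible process and its cause assignment are constructed together; without executed
    -- prefixes any assignment will do at the start.
    obtain ⟨f, h0, hS, hR⟩ := exists_fin_seq (α := RProc × Causes)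
      (fun i p => A i = p.1.toC p.2 ∧ Inv p.1 p.2 ∧ KeysBound N p.1 p.2)
      (fun i p q => ∃ μ, FStep p.1 μ q.1 ∧ ζ i = gamma μ ∧
        q.1.Rem μ.key (q.1.structCauses μ.key) = KB i)
      (RProc.initial P, fun _ => ∅)
      ⟨by rw [hA, RProc.toC_initial], inv_initial hP _, fun k hk => by
        rw [RProc.mem_keys, RProc.initial, RProc.occs_ofProc] at hk
        simp at hk⟩
      (by
        rintro i ⟨X, κ⟩ ⟨hAi, hinv, hkb⟩
        have hs := hstep i
        rw [hAi] at hs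
        obtain ⟨X', μ, κ', hf, hg, hA', hinv', hkb', hrem⟩ := hinv.exists_fstep hkb hs (hN i)
        exact ⟨(X', κ'), ⟨hA', hinv', hkb'⟩, μ, hf, hg, hrem⟩)
    choose μ hμ hg hrem using hR
    exact ⟨fun i => (f i).1, fun i => (f i.succ).1.structCauses (μ i).key, μ, by simp [h0],
      fun i => ⟨hμ i, rfl⟩, fun i => by rw [(hS i).1, RProc.erase_toC], hg, hrem⟩
  · intro X KF μ hX hstep
    -- Only the assignments have to be chosen here; the causal processes are read off from them.
    obtain ⟨f, h0, hS, hR⟩ := exists_fin_seq (α := Causes)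
      (fun i κ => Inv (X i) κ)
      (fun i κ κ' => ∃ K, BStep ((X i.castSucc).toC κ) K (gamma (μ i)) ((X i.succ).toC κ') ∧
        (X i.succ).Rem (μ i).key (KF i) = K)
      (fun _ => ∅) (hX ▸ inv_initial hP _)
      (by
        intro i κ hinv
        obtain ⟨κ', K, hb, hinv', hrem⟩ := hinv.exists_bstep (hstep i).1
        exact ⟨κ', hinv', K, hb, (hstep i).2 ▸ hrem⟩)
    choose K hb hrem using hR
    exact ⟨fun i => (X i).toC (f i), K, fun i => gamma (μ i), by
      simp only [hX, RProc.toC_initial], hb, fun i => RProc.erase_toC _ _, fun _ => rfl, hrem⟩
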